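/- Let $d\ge 2$, let $\mathcal P=(\mathcal P_t)_{t\ge0}$ be a continuous quantum Markov semigroup on $\mathcal B(\mathbb C^d)$ in the Heisenberg picture (a continuous semigroup of completely positive unital linear maps, $\mathcal P_0=\mathrm{id}$), with generator $\mathcal L=\lim_{t\to0^+}\frac1t(\mathcal P_t-\mathrm{id})$, and assume that $\mathcal P$ has a faithful invariant state, i.e. a density matrix $\sigma>0$ with $\operatorname{Tr}[\sigma\mathcal P_t(X)]=\operatorname{Tr}[\sigma X]$ for all $t\ge 0$ and all $X$. A subscript $*$ denotes the predual of a linear map: $\operatorname{Tr}[\Phi(X)Y]=\operatorname{Tr}[X\Phi_*(Y)]$. The decoherence-free algebra is $$\mathcal N(\mathcal P)=\{X:\ \mathcal P_t(X^*Y)=\mathcal P_t(X)^*\mathcal P_t(Y)\ \text{and}\ \mathcal P_t(YX^*)=\mathcal P_t(Y)\mathcal P_t(X)^*\ \ \forall t\ge0,\ \forall Y\}.$$ Let $E_{\mathcal N}$ be the associated conditional expectation, that is, the unique completely positive projection with range $\mathcal N(\mathcal P)$ and kernel $\{X:\lim_{t\to\infty}\mathcal P_t(X)=0\}$, compatible with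 the faithful invariant states ($\operatorname{Tr}[\sigma E_{\mathcal N}(X)]=\operatorname{Tr}[\sigma X]$ for each of them). Put $\rho_{\mathcal N}=E_{\mathcal N*}(\rho)$ for a density matrix $\rho$, $\sigma_{\operatorname{Tr}}=E_{\mathcal N*}(I/d)$, $\langle X,Y\rangle=\operatorname{Tr}[\sigma_{\operatorname{Tr}}^{1/2}X^*\sigma_{\operatorname{Tr}}^{1/2}Y]$ and $\|X\|_2^2=\langle X,X\rangle$. * $\lambda(\mathcal L)$ is the best (largest) constant $\lambda$ such that $\lambda\,\|X-E_{\mathcal N}(X)\|_2^2\le-\langle X,\mathcal L(X)\rangle$ for all selfadjoint $X$. * $\alpha_{\mathcal N}(\mathcal L)$ is the best constant $\alpha$ such that $2\alpha\,D(\rho\|\rho_{\mathcal N})\le \mathrm{EP}_{\mathcal L}(\rho)$ for all density matrices $\rho$, that is, $$\alpha_{\mathcal N}(\mathcal L)=\inf_{\rho\ne\rho_{\mathcal N}}\frac{\mathrm{EP}_{\mathcal L}(\rho)}{2D(\rho\|\rho_{\mathcal N})}.$$ Here $D(\rho\|\omega)=\operatorname{Tr}[\rho(\log\rho-\log\omega)]$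 if $\operatorname{supp}\rho\subseteq\operatorname{supp}\omega$ and $+\infty$ otherwise, and $\mathrm{EP}_{\mathcal L}(\rho)=-\operatorname{Tr}[\mathcal L_*(\rho)(\log\rho-\log\sigma_{\operatorname{Tr}})]$ with the conventions $-\log0=+\infty$ and $0\cdot\infty=0$: the value is $+\infty$ if the compression of $\mathcal L_*(\rho)$ to $\ker\rho$ is nonzero, and otherwise $\log\rho$ is taken on the support of $\rho$. **Theorem.** Suppose that $\mathcal N(\mathcal P)$ is the algebra of diagonal operators in an orthonormal basis $(e_i)_{i=1}^d$ of $\mathbb C^d$: $$\mathcal N(\mathcal P)=\Big\{\sum_{i=1}^d x_i\,|e_i\rangle\langle e_i|\ :\ x_i\in\mathbb C\Big\}.$$ Then there are complex numbers $\gamma_{ij}$ with $\mathcal L(|e_i\rangle\langle e_j|)=\gamma_{ij}\,|e_i\rangle\langle e_j|$ for all $i,j$, and $$0<\alpha_{\mathcal N}(\mathcal L)\le\lambda(\mathcal L)=\min_{i\ne j}\operatorname{Re}(-\gamma_{ij}).$$ -/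

import Mathlib

open Matrix Filter Topology
open scoped NNReal ComplexOrder

noncomputable section

namespace DFree

/-- The algebra `B(ℂ^d)`, as `d × d` complex matrices. -/
abbrev Mat (d : ℕ) : Type := Matrix (Fin d) (Fin d) ℂ

/-- The map `id_k ⊗ Φ`, applied blockwise to a `k × k` block matrix with blocks in `B(ℂ^d)`. -/
def ampliation {d : ℕ} (k : ℕ) (Φ : Mat d →ₗ[ℂ] Mat d)
    (M : Matrix (Fin k × Fin d) (Fin k × Fin d) ℂ) :
    Matrix (Fin k × Fin d) (Fin k × Fin d) ℂ :=
  Matrix.of fun p q => Φ (Matrix.of fun i j => M (p.1, i) (q.1, j)) p.2 q.2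

/-- Complete positivity: every `id_k ⊗ Φ` preserves positive semidefiniteness. -/
def IsCompletelyPositive {d : ℕ} (Φ : Mat d →ₗ[ℂ] Mat d) : Prop :=
  ∀ (k : ℕ) (M : Matrix (Fin k × Fin d) (Fin k × Fin d) ℂ),
    M.PosSemidef → (ampliation k Φ M).PosSemidef

/-- A continuous quantum Markov semigroup on `B(ℂ^d)`, in the Heisenberg picture. -/
structure QMS (d : ℕ) where
  map : ℝ≥0 → (Mat d →ₗ[ℂ] Mat d)
  map_zero : map 0 = LinearMap.id
  map_add : ∀ s t, map (s + t) = map s ∘ₗ map t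
  completelyPositive : ∀ t, IsCompletelyPositive (map t)
  unital : ∀ t, map t 1 = 1
  continuous_map : ∀ X, Continuous fun t => map t X

/-- Density matrices. -/
def IsState {d : ℕ} (ρ : Mat d) : Prop := ρ.PosSemidef ∧ ρ.trace = 1

/-- `Φ_*`, determined by `Tr[Φ(X) Y] = Tr[X Φ_*(Y)]` (see `trace_predual`). -/
def predual {d : ℕ} (Φ : Mat d →ₗ[ℂ] Mat d) : Mat d →ₗ[ℂ] Mat d where
  toFun Y := Matrix.of fun i j => (Φ (Matrix.single j i 1) * Y).trace
  map_add' Y Z := by ext i j; simp [mul_add]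
  map_smul' c Y := by ext i j; simp

theorem trace_predual {d : ℕ} (Φ : Mat d →ₗ[ℂ] Mat d) (X Y : Mat d) :
    (Φ X * Y).trace = (X * predual Φ Y).trace := by
  conv_lhs => rw [Matrix.matrix_eq_sum_single X]
  have h : ∀ i j, Matrix.single i j (X i j) = X i j • Matrix.single i j (1 : ℂ) := by
    intro i j; simp
  simp only [h, map_sum, map_smul, Finset.sum_mul, Matrix.trace_sum, Matrix.smul_mul,
    Matrix.trace_smul]
  simp [Matrix.trace, Matrix.mul_apply, predual]

namespace QMS

variable {d : ℕ}

/-- `L = lim_{t → 0+} (P_t - I) / t`, pointwise on `B(ℂ^d)`. -/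
def IsGenerator (P : QMS d) (L : Mat d →ₗ[ℂ] Mat d) : Prop :=
  ∀ X, Tendsto (fun t : ℝ≥0 => ((t : ℝ)⁻¹) • (P.map t X - X)) (𝓝[≠] 0) (𝓝 (L X))

open Classical in
/-- The generator (Lindbladian) of the semigroup; it is unique, and the value `0` is never used
since a continuous semigroup on a finite-dimensional space has a generator. -/
def generator (P : QMS d) : Mat d →ₗ[ℂ] Mat d :=
  if h : ∃ L, P.IsGenerator L then h.choose else 0

/-- Invariance of a state: `σ(P_t(X)) = σ(X)`. -/
def IsInvariant (P : QMS d) (σ : Mat d) : Prop :=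
  ∀ t X, (σ * P.map t X).trace = (σ * X).trace

/-- Faithful invariant states. -/
def IsFaithfulInvariantState (P : QMS d) (σ : Mat d) : Prop :=
  IsState σ ∧ σ.PosDef ∧ P.IsInvariant σ

/-- The decoherence-free algebra `N(P)`. -/
def dfAlgebra (P : QMS d) : Set (Mat d) :=
  {X | ∀ t Y, P.map t (Xᴴ * Y) = (P.map t X)ᴴ * P.map t Y ∧
    P.map t (Y * Xᴴ) = P.map t Y * (P.map t X)ᴴ}

/-- `E` is the conditional expectation onto `N(P)` attached to the semigroup: a completely positive
projection with range `N(P)`, compatible with the faithful invariant states, whose kernel consists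
of the observables that vanish in the long time. -/
structure IsDFExpectation (P : QMS d) (E : Mat d →ₗ[ℂ] Mat d) : Prop where
  completelyPositive : IsCompletelyPositive E
  idempotent : ∀ X, E (E X) = E X
  range_eq : Set.range E = P.dfAlgebra
  compatible : ∀ σ, P.IsFaithfulInvariantState σ → ∀ X, (σ * E X).trace = (σ * X).trace
  ker_iff : ∀ X, E X = 0 ↔ Tendsto (fun t => P.map t X) atTop (𝓝 0)

open Classical in
/-- The conditional expectation `E_N`. It is unique (a projection is determined by its range and
its kernel); it exists when there is a faithful invariant state, so `0` is then not used. -/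
def dfExpectation (P : QMS d) : Mat d →ₗ[ℂ] Mat d :=
  if h : ∃ E, P.IsDFExpectation E then h.choose else 0

/-- `ρ_N = E_{N*}(ρ)`. -/
def dfState (P : QMS d) (ρ : Mat d) : Mat d := predual P.dfExpectation ρ

/-- The reference state `σ_Tr = E_{N*}(I / d)`. -/
def refState (P : QMS d) : Mat d := P.dfState (((d : ℂ)⁻¹) • (1 : Mat d))

end QMS

/-- `⟨X, Y⟩_σ = Tr[σ^{1/2} X* σ^{1/2} Y]`. -/
def weightedInner {d : ℕ} (σ X Y : Mat d) : ℂ :=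
  (cfc Real.sqrt σ * Xᴴ * cfc Real.sqrt σ * Y).trace

/-- The relative entropy `D(ρ‖σ) = Tr[ρ (log ρ - log σ)]` if `supp ρ ⊆ supp σ` (that is,
`ker σ ⊆ ker ρ`), and `+∞` otherwise. The logarithms are taken on the supports. -/
def relEntropy {d : ℕ} (ρ σ : Mat d) : EReal :=
  open Classical in
  if ∀ v : Fin d → ℂ, σ *ᵥ v = 0 → ρ *ᵥ v = 0 then
    (((ρ * (cfc Real.log ρ - cfc Real.log σ)).trace.re : ℝ) : EReal)
  else ⊤

namespace QMS

variable {d : ℕ}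

/-- The Dirichlet form `-⟨X, L(X)⟩` at the reference state; it is real for selfadjoint `X`. -/
def dirichlet (P : QMS d) (X : Mat d) : ℝ :=
  -(weightedInner P.refState X (P.generator X)).re

/-- The decoherence-free variance `‖X - E_N(X)‖²` in the norm of the reference state. -/
def dfVariance (P : QMS d) (X : Mat d) : ℝ :=
  (weightedInner P.refState (X - P.dfExpectation X) (X - P.dfExpectation X)).re

/-- The decoherence-free Poincaré inequality with constant `c`. -/
def PoincareIneq (P : QMS d) (c : ℝ) : Prop :=
  ∀ X : Mat d, X.IsHermitian → c * P.dfVariance X ≤ P.dirichlet X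

/-- `λ(L)`: the best constant in the decoherence-free Poincaré inequality. -/
def poincareConst (P : QMS d) : EReal :=
  ⨆ (c : ℝ) (_ : P.PoincareIneq c), (c : EReal)

/-- The decoherence-free relative entropy `D(ρ‖ρ_N)`. -/
def dfEntropy (P : QMS d) (ρ : Mat d) : EReal := relEntropy ρ (P.dfState ρ)

/-- The entropy production `-Tr[L_*(ρ) (log ρ - log σ_Tr)]`, with values in `(-∞, +∞]`.
For a state `ρ` that is not faithful, `-log ρ` is `+∞` on `ker ρ`, where `L_*(ρ)` has a positive
semidefinite compression: the value is `+∞` unless that compression vanishes, in which case (by the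
convention `0 · ∞ = 0`) only `log ρ` on the support of `ρ` counts. This is also the value of
`-d/dt D(P_{*t}(ρ)‖σ_Tr)` at `t = 0+`. -/
def entropyProduction (P : QMS d) (ρ : Mat d) : EReal :=
  open Classical in
  if ∀ v : Fin d → ℂ, ρ *ᵥ v = 0 → star v ⬝ᵥ (predual P.generator ρ *ᵥ v) = 0 then
    ((-(predual P.generator ρ * (cfc Real.log ρ - cfc Real.log P.refState)).trace.re : ℝ) : EReal)
  else ⊤

/-- `α_N(L) = inf_ρ EP_L(ρ) / (2 D(ρ‖ρ_N))`: the best constant in the modified decoherence-free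
log-Sobolev inequality. States with `ρ = ρ_N`, where both sides of that inequality vanish, are left
out of the infimum of the quotients. -/
def logSobolevConst (P : QMS d) : EReal :=
  ⨅ (ρ : Mat d) (_ : IsState ρ) (_ : P.dfState ρ ≠ ρ), P.entropyProduction ρ / (2 * P.dfEntropy ρ)

end QMS

/-- The operator `|e_i⟩⟨e_j|`. -/
def ketBra {d : ℕ} (e : OrthonormalBasis (Fin d) ℂ (EuclideanSpace ℂ (Fin d))) (i j : Fin d) :
    Mat d :=
  Matrix.vecMulVec (fun a => e i a) (fun b => star (e j b))

/-- The algebra of operators that are diagonal in the orthonormal basis `e`. -/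
def diagonalAlgebra {d : ℕ} (e : OrthonormalBasis (Fin d) ℂ (EuclideanSpace ℂ (Fin d))) :
    Set (Mat d) :=
  {X | ∃ x : Fin d → ℂ, X = ∑ i, x i • ketBra e i i}

end DFree

end

/-!
Write `e_ij = |e_i⟩⟨e_j|` and let `U` be the unitary matrix whose columns are the `e_i`.

*Structure.* Each `P_t` is invertible, hence leaves the decoherence-free algebra invariant, and it
moves the projections `e_ii` continuously through the finite set of diagonal projections; so it
fixes them. Multiplicativity on `N(P)` then gives `P_t(e_ii X e_jj) = e_ii P_t(X) e_jj`: in the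
basis `e`, `P_t` is a Schur multiplier `(exp (t γ_ij))_ij` (`QMS.exists_schurGenerator`). Positivity
of the multiplier shows that `Re γ_ij ≥ 0` would put `e_ij` into `N(P)`, so `Re γ_ij < 0` for
`i ≠ j`. Hence `E_N` is the pinching onto the diagonal, `σ_Tr = 1 / d`, and the Poincaré inequality
is the comparison of two weighted sums of the `|X_ij|²`; the best constant is
`λ = min_{i ≠ j} Re (-γ_ij)` (`IsSchurSemigroup.poincareConst_eq`).

*Upper bound.* The states `(1 + ε (e_ij + e_ji)) / d` have quotient `EP / 2D → Re (-γ_ij)` as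
`ε → 0` (`IsSchurSemigroup.logSobolevConst_le`).

*Positivity of the log-Sobolev constant.* Since `γ` may have non-real entries, the entropy
production is not a Dirichlet form of logarithmic means. With `log x = ∫_0^∞ (1 / (1 + s) - 1 / (x + s)) ds`,
it is the integral over `s` of `Tr[L_*(ρ) (ρ + s)⁻¹]`, and it suffices to bound this
below, at every `s`, by a multiple of the integrand `s (Tr (ρ + s)⁻¹ - Tr (ρ_N + s)⁻¹)` of
`D(ρ‖ρ_N)`. The diagonal matrix `ρ_N + s` commutes with Schur multipliers, so in
`Tr[L_*(ρ) (ρ + s)⁻¹]` one may replace `ρ + s` by the correlation matrix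
`B = (ρ_N + s)^{-1/2} (ρ + s) (ρ_N + s)^{-1/2}`, which has unit diagonal and therefore `B ≤ d`. For
bounded `B`, double stochasticity and an elementary inequality for the logarithm give
`Tr[L_*(B) B⁻¹] ≥ (2 d²)⁻¹ (-Tr[B L_*(B)]) ≥ λ (2 d²)⁻¹ ‖B - 1‖²`
(`IsSchurMultiplier.trace_mul_inv_ge`), while the integrand of the relative entropy is at
most `4 d ‖B - 1‖²` (`IsSchurGenerator.integrand_le`). This gives `α_N ≥ λ / (16 d³)`.
-/

noncomputable section

namespace DFree

variable {d : ℕ}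

/-! ### Functional calculus through a diagonalisation -/

/-- The matrix `V diag(r) Vᴴ` for real `r`. -/
def spectralMat (V : Mat d) (r : Fin d → ℝ) : Mat d :=
  V * diagonal (fun i => (r i : ℂ)) * Vᴴ

theorem isHermitian_spectralMat (V : Mat d) (r : Fin d → ℝ) : (spectralMat V r).IsHermitian := by
  simp only [spectralMat, IsHermitian, conjTranspose_mul, conjTranspose_conjTranspose,
    diagonal_conjTranspose, mul_assoc]
  congr 3
  ext i
  simp

theorem spectralMat_mul {V : Mat d} (hV : Vᴴ * V = 1) (r s : Fin d → ℝ) :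
    spectralMat V r * spectralMat V s = spectralMat V (fun i => r i * s i) := by
  have h : spectralMat V r * spectralMat V s =
      V * (diagonal (fun i => (r i : ℂ)) * (Vᴴ * V) * diagonal (fun i => (s i : ℂ))) * Vᴴ := by
    simp only [spectralMat, mul_assoc]
  rw [h, hV, mul_one, diagonal_mul_diagonal]
  simp [spectralMat]

theorem spectralMat_add (V : Mat d) (r s : Fin d → ℝ) :
    spectralMat V r + spectralMat V s = spectralMat V (fun i => r i + s i) := by
  simp only [spectralMat, ← add_mul, ← mul_add, diagonal_add]
  simp

theorem spectralMat_const {V : Mat d} (hV : V * Vᴴ = 1) (c : ℝ) :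
    spectralMat V (fun _ => c) = (c : ℂ) • (1 : Mat d) := by
  have : diagonal (fun _ : Fin d => (c : ℂ)) = (c : ℂ) • (1 : Mat d) := by
    rw [smul_one_eq_diagonal]
  rw [spectralMat, this, mul_smul_comm, mul_one, smul_mul_assoc, hV]

theorem trace_spectralMat {V : Mat d} (hV : Vᴴ * V = 1) (r : Fin d → ℝ) :
    (spectralMat V r).trace = ((∑ i, r i : ℝ) : ℂ) := by
  rw [spectralMat, trace_mul_comm, ← mul_assoc, hV, one_mul, trace_diagonal]
  simp

theorem spectralMat_inv {V : Mat d} (hV : Vᴴ * V = 1) (hV' : V * Vᴴ = 1) {r : Fin d → ℝ}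
    (hr : ∀ i, r i ≠ 0) : (spectralMat V r)⁻¹ = spectralMat V (fun i => (r i)⁻¹) := by
  apply inv_eq_right_inv
  rw [spectralMat_mul hV]
  simp only [mul_inv_cancel₀ (hr _)]
  rw [spectralMat_const hV']
  simp

theorem conj_spectralMat (U V : Mat d) (r : Fin d → ℝ) :
    U * spectralMat V r * Uᴴ = spectralMat (U * V) r := by
  simp only [spectralMat, conjTranspose_mul, mul_assoc]

theorem posSemidef_spectralMat (V : Mat d) {r : Fin d → ℝ} (hr : ∀ i, 0 ≤ r i) :
    (spectralMat V r).PosSemidef := by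
  refine PosSemidef.mul_mul_conjTranspose_same (PosSemidef.diagonal ?_) V
  intro i
  simpa using hr i

theorem exists_eq_spectralMat {A : Mat d} (hA : A.IsHermitian) :
    ∃ (V : Mat d) (r : Fin d → ℝ), Vᴴ * V = 1 ∧ V * Vᴴ = 1 ∧ A = spectralMat V r := by
  refine ⟨hA.eigenvectorUnitary, hA.eigenvalues, ?_, ?_, ?_⟩
  · exact Unitary.coe_star_mul_self hA.eigenvectorUnitary
  · exact Unitary.coe_mul_star_self hA.eigenvectorUnitary
  · conv_lhs => rw [hA.spectral_theorem]
    rfl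

theorem nonneg_of_posSemidef_spectralMat {V : Mat d} (hV : Vᴴ * V = 1) {r : Fin d → ℝ}
    (h : (spectralMat V r).PosSemidef) (i : Fin d) : 0 ≤ r i := by
  have h1 := h.conjTranspose_mul_mul_same V
  have h2 : Vᴴ * spectralMat V r * V = diagonal (fun i => (r i : ℂ)) := by
    have : Vᴴ * spectralMat V r * V =
        (Vᴴ * V) * diagonal (fun i => (r i : ℂ)) * (Vᴴ * V) := by
      simp only [spectralMat, mul_assoc]
    rw [this, hV, one_mul, mul_one]
  rw [h2] at h1
  have := h1.diag_nonneg (i := i)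
  simpa using this

theorem pos_of_posDef_spectralMat {V : Mat d} (hV : Vᴴ * V = 1) {r : Fin d → ℝ}
    (h : (spectralMat V r).PosDef) (i : Fin d) : 0 < r i := by
  have h1 : (Vᴴ * spectralMat V r * V).PosDef := by
    refine h.conjTranspose_mul_mul_same ?_
    intro x y hxy
    have := congrArg (fun z => Vᴴ *ᵥ z) hxy
    simpa [mulVec_mulVec, hV] using this
  have h2 : Vᴴ * spectralMat V r * V = diagonal (fun i => (r i : ℂ)) := by
    have : Vᴴ * spectralMat V r * V =
        (Vᴴ * V) * diagonal (fun i => (r i : ℂ)) * (Vᴴ * V) := by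
      simp only [spectralMat, mul_assoc]
    rw [this, hV, one_mul, mul_one]
  rw [h2] at h1
  have := h1.diag_pos (i := i)
  simpa using this

/-- Any unitary diagonalisation, not only that by the eigenvectors chosen in Mathlib, computes the
functional calculus. -/
theorem cfc_spectralMat {V : Mat d} (hV : Vᴴ * V = 1) (hV' : V * Vᴴ = 1) (r : Fin d → ℝ)
    (f : ℝ → ℝ) : cfc f (spectralMat V r) = spectralMat V (fun i => f (r i)) := by
  -- on a finite set of points `f` agrees with a polynomial
  obtain ⟨q, hq⟩ : ∃ q : Polynomial ℝ, ∀ x ∈ spectrum ℝ (spectralMat V r) ∪ Set.range r,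
      q.eval x = f x := by
    have hfin : (spectrum ℝ (spectralMat V r) ∪ Set.range r).Finite :=
      Set.Finite.union Matrix.finite_real_spectrum (Set.finite_range r)
    refine ⟨Lagrange.interpolate hfin.toFinset id f, fun x hx => ?_⟩
    have := Lagrange.eval_interpolate_at_node (s := hfin.toFinset) (v := id) f
      Function.injective_id.injOn (hfin.mem_toFinset.2 hx)
    simpa using this
  rw [cfc_congr (g := fun x => q.eval x) (fun x hx => (hq x (Or.inl hx)).symm),
    cfc_polynomial q _ (isHermitian_spectralMat V r).isSelfAdjoint]
  have key : ∀ q : Polynomial ℝ, Polynomial.aeval (spectralMat V r) q =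
      spectralMat V (fun i => q.eval (r i)) := by
    intro q
    induction q using Polynomial.induction_on' with
    | add p q hp hq => simp only [map_add, hp, hq, spectralMat_add, Polynomial.eval_add]
    | monomial n a =>
      rw [Polynomial.aeval_monomial]
      simp only [Polynomial.eval_monomial]
      have hpow : (spectralMat V r) ^ n = spectralMat V (fun i => r i ^ n) := by
        induction n with
        | zero => simp only [pow_zero]; rw [spectralMat_const hV']; simp
        | succ n ih => rw [pow_succ, ih, spectralMat_mul hV]; simp only [pow_succ]
      have ha : algebraMap ℝ (Mat d) a = spectralMat V (fun _ => a) := by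
        rw [spectralMat_const hV', Algebra.algebraMap_eq_smul_one]
        ext i j
        simp [Matrix.smul_apply]
      rw [hpow, ha, spectralMat_mul hV]
  rw [key]
  congr 1
  ext i
  exact hq _ (Or.inr ⟨i, rfl⟩)

theorem spectralMat_mulVec {V : Mat d} (hV : Vᴴ * V = 1) (r : Fin d → ℝ) (a : Fin d) :
    spectralMat V r *ᵥ (V.col a) = (r a : ℂ) • V.col a := by
  have h1 : V.col a = V *ᵥ Pi.single a 1 := by simp
  rw [h1, mulVec_mulVec, spectralMat, mul_assoc, hV, mul_one, ← mulVec_mulVec,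
    diagonal_mulVec_single, ← Matrix.mulVec_smul]
  congr 1
  ext i
  simp [Pi.single_apply]

theorem trace_mul_spectralMat (M V : Mat d) (r : Fin d → ℝ) :
    (M * spectralMat V r).trace = ∑ a, (r a : ℂ) * (star (V.col a) ⬝ᵥ (M *ᵥ V.col a)) := by
  rw [spectralMat, ← mul_assoc, trace_mul_comm, ← mul_assoc, ← mul_assoc, trace]
  refine Finset.sum_congr rfl fun a _ => ?_
  rw [diag_apply, mul_diagonal, mul_comm, mul_assoc]
  congr 1

/-! ### Positive Schur multipliers -/

/-- A unital positive Schur multiplier: `X ↦ p ⊙ X` is a positive, unital and trace preserving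
map. -/
structure IsSchurMultiplier (p : Mat d) : Prop where
  diag_eq_one : ∀ i, p i i = 1
  posSemidef : ∀ X : Mat d, X.PosSemidef → (p ⊙ X).PosSemidef

theorem spectralMat_eq_sum (V : Mat d) (g : Fin d → ℝ) :
    spectralMat V g = ∑ c, (g c : ℂ) • spectralMat V (Pi.single c 1) := by
  have h : diagonal (fun i => (g i : ℂ)) =
      ∑ c, (g c : ℂ) • diagonal (fun i => ((Pi.single c 1 : Fin d → ℝ) i : ℂ)) := by
    ext i j
    rw [Matrix.sum_apply]
    by_cases hij : i = j
    · subst hij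
      simp [Pi.single_apply, apply_ite]
    · simp [hij]
  simp only [spectralMat, h, Finset.mul_sum, Finset.sum_mul, mul_smul_comm, smul_mul_assoc]

/-- The transition weights `⟨v_a| p ⊙ |v_c⟩⟨v_c| |v_a⟩` of a Schur multiplier between the columns
`v_a`, `v_c` of `V`. -/
def transitionWeight (p V : Mat d) (a c : Fin d) : ℝ :=
  (star (V.col a) ⬝ᵥ ((p ⊙ spectralMat V (Pi.single c 1)) *ᵥ V.col a)).re

theorem re_trace_spectralMat_mul_hadamard (p V : Mat d) (f g : Fin d → ℝ) :
    (spectralMat V f * (p ⊙ spectralMat V g)).trace.re =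
      ∑ a, ∑ c, transitionWeight p V a c * (f a * g c) := by
  have h : p ⊙ spectralMat V g = ∑ c, (g c : ℂ) • (p ⊙ spectralMat V (Pi.single c 1)) := by
    rw [spectralMat_eq_sum V g]
    ext i j
    simp [Matrix.sum_apply, Finset.mul_sum, mul_left_comm]
  rw [trace_mul_comm, trace_mul_spectralMat, Complex.re_sum]
  refine Finset.sum_congr rfl fun a _ => ?_
  rw [h, sum_mulVec, dotProduct_sum, Finset.mul_sum, Complex.re_sum]
  refine Finset.sum_congr rfl fun c _ => ?_
  rw [smul_mulVec, dotProduct_smul, smul_eq_mul, ← mul_assoc, ← Complex.ofReal_mul,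
    Complex.re_ofReal_mul, transitionWeight]
  ring

namespace IsSchurMultiplier

variable {p : Mat d}

theorem transitionWeight_nonneg (hp : IsSchurMultiplier p) (V : Mat d) (a c : Fin d) :
    0 ≤ transitionWeight p V a c := by
  have h : (p ⊙ spectralMat V (Pi.single c 1)).PosSemidef := by
    refine hp.posSemidef _ (posSemidef_spectralMat V fun i => ?_)
    by_cases h : i = c <;> simp [h]
  exact h.re_dotProduct_nonneg _

theorem hadamard_one_eq (hp : IsSchurMultiplier p) : p ⊙ (1 : Mat d) = 1 := by
  rw [hadamard_one]
  ext i j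
  by_cases h : i = j
  · subst h
    simp [hp.diag_eq_one]
  · simp [h]

theorem trace_hadamard (hp : IsSchurMultiplier p) (X : Mat d) : (p ⊙ X).trace = X.trace := by
  simp [trace, hp.diag_eq_one]

theorem sum_transitionWeight_right (hp : IsSchurMultiplier p) {V : Mat d} (hV : Vᴴ * V = 1)
    (hV' : V * Vᴴ = 1) (f : Fin d → ℝ) :
    ∑ a, ∑ c, transitionWeight p V a c * f a = ∑ a, f a := by
  have h := re_trace_spectralMat_mul_hadamard p V f (fun _ => 1)
  rw [spectralMat_const hV', Complex.ofReal_one, one_smul, hp.hadamard_one_eq, mul_one,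
    trace_spectralMat hV, Complex.ofReal_re] at h
  simpa using h.symm

theorem sum_transitionWeight_left (hp : IsSchurMultiplier p) {V : Mat d} (hV : Vᴴ * V = 1)
    (hV' : V * Vᴴ = 1) (g : Fin d → ℝ) :
    ∑ a, ∑ c, transitionWeight p V a c * g c = ∑ a, g a := by
  have h := re_trace_spectralMat_mul_hadamard p V (fun _ => 1) g
  rw [spectralMat_const hV', Complex.ofReal_one, one_smul, one_mul, hp.trace_hadamard,
    trace_spectralMat hV, Complex.ofReal_re] at h
  simpa using h.symm

end IsSchurMultiplier

/-- A quantitative form of `log u ≤ u - 1` for `u = x / y`, from the same bound for `√u`. -/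
theorem sq_sub_le_div_sub_log {x y R : ℝ} (hx : 0 < x) (hy : 0 < y) (hxR : x ≤ R) (hyR : y ≤ R) :
    (x - y) ^ 2 / (4 * R ^ 2) ≤ x / y - 1 - (Real.log x - Real.log y) := by
  obtain ⟨u, hu, rfl⟩ : ∃ u : ℝ, 0 < u ∧ u ^ 2 = x := ⟨√x, Real.sqrt_pos.2 hx, Real.sq_sqrt hx.le⟩
  obtain ⟨v, hv, rfl⟩ : ∃ v : ℝ, 0 < v ∧ v ^ 2 = y := ⟨√y, Real.sqrt_pos.2 hy, Real.sq_sqrt hy.le⟩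
  have hR : 0 < R := hx.trans_le hxR
  have hlog := Real.log_le_sub_one_of_pos (div_pos hu hv)
  rw [Real.log_div hu.ne' hv.ne'] at hlog
  have h1 : (u - v) ^ 2 / v ^ 2 ≤ u ^ 2 / v ^ 2 - 1 - (Real.log (u ^ 2) - Real.log (v ^ 2)) := by
    have : (u - v) ^ 2 / v ^ 2 = u ^ 2 / v ^ 2 - 1 - 2 * (u / v - 1) := by
      field_simp
      ring
    rw [this, Real.log_pow, Real.log_pow]
    push_cast
    linarith
  refine le_trans ?_ h1
  rw [div_le_div_iff₀ (by positivity) (by positivity)]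
  have h2 : (u + v) ^ 2 * v ^ 2 ≤ 4 * R ^ 2 := by
    have h3 : (u + v) ^ 2 ≤ 4 * R := by nlinarith [sq_nonneg (u - v)]
    calc (u + v) ^ 2 * v ^ 2 ≤ (4 * R) * R := by gcongr
      _ = 4 * R ^ 2 := by ring
  calc (u ^ 2 - v ^ 2) ^ 2 * v ^ 2 = (u - v) ^ 2 * ((u + v) ^ 2 * v ^ 2) := by ring
    _ ≤ (u - v) ^ 2 * (4 * R ^ 2) := by gcongr

/-- Positivity, unitality and trace preservation give a lower bound of the "entropy production"
`Tr[B (Φ(B⁻¹) - B⁻¹)]` by the Dirichlet form of `B`. The weights are doubly stochastic, so that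
differences of `log` of the eigenvalues may be subtracted from the summands for free. -/
theorem IsSchurMultiplier.trace_mul_inv_ge {p : Mat d} (hp : IsSchurMultiplier p) {V : Mat d}
    (hV : Vᴴ * V = 1) (hV' : V * Vᴴ = 1) {b : Fin d → ℝ} {R : ℝ} (hb : ∀ i, 0 < b i)
    (hbR : ∀ i, b i ≤ R) :
    (1 / (2 * R ^ 2)) * (spectralMat V b * (spectralMat V b - p ⊙ spectralMat V b)).trace.re ≤
      (spectralMat V b * (p ⊙ (spectralMat V b)⁻¹ - (spectralMat V b)⁻¹)).trace.re := by
  set w := transitionWeight p V with hw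
  have hw0 : ∀ a c, 0 ≤ w a c := hp.transitionWeight_nonneg V
  have hl := hp.sum_transitionWeight_left hV hV'
  have hr := hp.sum_transitionWeight_right hV hV'
  rw [spectralMat_inv hV hV' (fun i => (hb i).ne')]
  simp only [mul_sub, trace_sub, Complex.sub_re, re_trace_spectralMat_mul_hadamard,
    spectralMat_mul hV, trace_spectralMat hV, Complex.ofReal_re, ← hw]
  have key : ∑ a, ∑ c, w a c * ((b a - b c) ^ 2 / (4 * R ^ 2)) ≤
      ∑ a, ∑ c, w a c * (b a / b c - 1 - (Real.log (b a) - Real.log (b c))) :=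
    Finset.sum_le_sum fun a _ => Finset.sum_le_sum fun c _ =>
      mul_le_mul_of_nonneg_left (sq_sub_le_div_sub_log (hb a) (hb c) (hbR a) (hbR c)) (hw0 a c)
  have e1 : ∑ a, ∑ c, w a c * ((b a - b c) ^ 2 / (4 * R ^ 2)) =
      1 / (4 * R ^ 2) * (∑ a, ∑ c, w a c * (b a * b a) + ∑ a, ∑ c, w a c * (b c * b c)
        - 2 * ∑ a, ∑ c, w a c * (b a * b c)) := by
    simp only [Finset.mul_sum, ← Finset.sum_add_distrib, ← Finset.sum_sub_distrib]
    refine Finset.sum_congr rfl fun a _ => Finset.sum_congr rfl fun c _ => ?_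
    ring
  have e2 : ∑ a, ∑ c, w a c * (b a / b c - 1 - (Real.log (b a) - Real.log (b c))) =
      ∑ a, ∑ c, w a c * (b a * (b c)⁻¹) - ∑ a, ∑ c, w a c * (1 : ℝ)
        - (∑ a, ∑ c, w a c * Real.log (b a) - ∑ a, ∑ c, w a c * Real.log (b c)) := by
    simp only [← Finset.sum_sub_distrib]
    refine Finset.sum_congr rfl fun a _ => Finset.sum_congr rfl fun c _ => ?_
    ring
  rw [e1, e2, hr (fun a => b a * b a), hl (fun a => b a * b a), hr (fun a => Real.log (b a)),
    hl (fun a => Real.log (b a)), hr (fun _ => 1)] at key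
  have e3 : ∀ a, b a * (b a)⁻¹ = 1 := fun a => mul_inv_cancel₀ (hb a).ne'
  simp only [e3]
  calc _ = 1 / (4 * R ^ 2) * (∑ a, b a * b a + ∑ a, b a * b a
        - 2 * ∑ a, ∑ c, w a c * (b a * b c)) := by
        field_simp
        ring
    _ ≤ _ := key.trans (le_of_eq (by ring))

/-! ### Semigroups of Schur multipliers -/

/-- The entrywise exponential `(exp (t γ_ij))_ij`. -/
def expMultiplier (γ : Mat d) (t : ℝ) : Mat d :=
  Matrix.of fun i j => Complex.exp (t * γ i j)

/-- `γ` generates a semigroup of unital positive Schur multipliers. -/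
structure IsSchurGenerator (γ : Mat d) : Prop where
  diag_eq_zero : ∀ i, γ i i = 0
  isSchurMultiplier : ∀ t : ℝ, 0 ≤ t → IsSchurMultiplier (expMultiplier γ t)

theorem expMultiplier_zero_hadamard (γ X : Mat d) : expMultiplier γ 0 ⊙ X = X := by
  ext i j
  simp [expMultiplier]

theorem hasDerivAt_trace_expMultiplier (γ M X : Mat d) :
    HasDerivAt (fun t : ℝ => (M * (expMultiplier γ t ⊙ X)).trace.re)
      (M * (γ ⊙ X)).trace.re 0 := by
  have h : HasDerivAt (fun t : ℝ => (M * (expMultiplier γ t ⊙ X)).trace)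
      (M * (γ ⊙ X)).trace 0 := by
    simp only [trace, diag_apply, mul_apply, hadamard_apply, expMultiplier, of_apply]
    refine HasDerivAt.fun_sum fun i _ => HasDerivAt.fun_sum fun j _ => ?_
    have h1 : HasDerivAt (fun t : ℝ => Complex.exp ((t : ℂ) * γ j i))
        (γ j i) 0 := by
      have h2 : HasDerivAt (fun t : ℝ => (t : ℂ) * γ j i) (1 * γ j i) 0 :=
        (Complex.ofRealCLM.hasDerivAt (x := (0 : ℝ))).mul_const _
      simpa using h2.cexp
    exact (h1.mul_const (X j i)).const_mul (M i j)
  exact (Complex.reCLM.hasFDerivAt.comp_hasDerivAt 0 h)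

theorem nonneg_of_hasDerivAt_of_le {f : ℝ → ℝ} {c : ℝ} (hf : HasDerivAt f c 0)
    (h : ∀ t, 0 ≤ t → f 0 ≤ f t) : 0 ≤ c := by
  have h1 := (hasDerivAt_iff_tendsto_slope.1 hf).mono_left
    (nhdsWithin_mono (0 : ℝ) (fun x (hx : 0 < x) => hx.ne') : 𝓝[>] (0 : ℝ) ≤ _)
  refine ge_of_tendsto h1 ?_
  filter_upwards [self_mem_nhdsWithin] with t ht
  have ht : 0 < t := ht
  rw [slope_def_field]
  exact div_nonneg (sub_nonneg.2 (h t ht.le)) (by linarith)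

namespace IsSchurGenerator

variable {γ : Mat d}

theorem re_symm (hγ : IsSchurGenerator γ) (i j : Fin d) : (γ j i).re = (γ i j).re := by
  have h1 : (Matrix.of fun _ _ => 1 : Mat d).PosSemidef := by
    simpa [vecMulVec, Pi.star_def] using posSemidef_vecMulVec_self_star (fun _ : Fin d => (1 : ℂ))
  have h2 := ((hγ.isSchurMultiplier 1 zero_le_one).posSemidef _ h1).isHermitian.apply i j
  have h3 := congrArg norm h2
  simpa [expMultiplier, Complex.norm_exp] using h3

/-- The derivative at `t = 0` of `IsSchurMultiplier.trace_mul_inv_ge`. -/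
theorem trace_hadamard_inv_ge (hγ : IsSchurGenerator γ) {V : Mat d}
    (hV : Vᴴ * V = 1) (hV' : V * Vᴴ = 1) {b : Fin d → ℝ} {R : ℝ} (hb : ∀ i, 0 < b i)
    (hbR : ∀ i, b i ≤ R) :
    (1 / (2 * R ^ 2)) * -(spectralMat V b * (γ ⊙ spectralMat V b)).trace.re ≤
      (spectralMat V b * (γ ⊙ (spectralMat V b)⁻¹)).trace.re := by
  set B := spectralMat V b
  have h := nonneg_of_hasDerivAt_of_le ((hasDerivAt_trace_expMultiplier γ B B⁻¹).add
    ((hasDerivAt_trace_expMultiplier γ B B).const_mul (1 / (2 * R ^ 2)))) (fun t ht => ?_)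
  · linarith
  · have := (hγ.isSchurMultiplier t ht).trace_mul_inv_ge hV hV' hb hbR
    simp only [mul_sub, trace_sub, Complex.sub_re] at this
    simp only [Pi.add_apply, expMultiplier_zero_hadamard]
    linarith

end IsSchurGenerator

theorem re_trace_mul_hadamard_self {B : Mat d} (hB : B.IsHermitian) (γ : Mat d) :
    (B * (γ ⊙ B)).trace.re = ∑ i, ∑ j, (γ j i).re * ‖B i j‖ ^ 2 := by
  simp only [trace, diag_apply, mul_apply, hadamard_apply, Complex.re_sum]
  refine Finset.sum_congr rfl fun i _ => Finset.sum_congr rfl fun j _ => ?_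
  have h : B i j * (γ j i * B j i) = ((‖B i j‖ ^ 2 : ℝ) : ℂ) * γ j i := by
    rw [← hB.apply j i, ← mul_assoc, mul_comm (B i j), mul_assoc]
    rw [mul_comm]
    congr 1
    rw [Complex.star_def, Complex.mul_conj, Complex.normSq_eq_norm_sq]
  rw [h, Complex.re_ofReal_mul, mul_comm]

namespace IsSchurGenerator

variable {γ : Mat d}

/-- The case of a correlation matrix `B`, that is, of unit diagonal: the eigenvalues are then at
most `d`. -/
theorem trace_hadamard_inv_ge_of_diag_eq_one (hγ : IsSchurGenerator γ) {g : ℝ}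
    (hγg : ∀ i j, i ≠ j → g ≤ -(γ i j).re) {V : Mat d}
    (hV : Vᴴ * V = 1) (hV' : V * Vᴴ = 1) {b : Fin d → ℝ} (hb : ∀ i, 0 < b i)
    (hdiag : ∀ i, spectralMat V b i i = 1) :
    g * ∑ a, (b a - 1) ^ 2 ≤
      2 * d ^ 2 * (spectralMat V b * (γ ⊙ (spectralMat V b)⁻¹)).trace.re := by
  have hsum : ∑ a, b a = d := by
    have h := trace_spectralMat hV b
    simp only [trace, diag_apply, hdiag] at h
    simp only [Finset.sum_const, Finset.card_univ, Fintype.card_fin, nsmul_eq_mul, mul_one] at h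
    exact_mod_cast h.symm
  have hbd : ∀ a, b a ≤ d := fun a => by
    rw [← hsum]
    exact Finset.single_le_sum (fun i _ => (hb i).le) (Finset.mem_univ a)
  have h1 := hγ.trace_hadamard_inv_ge hV hV' hb hbd
  have hB := isHermitian_spectralMat V b
  have hsq : ∑ a, (b a - 1) ^ 2 =
      ∑ i, ∑ j, (‖spectralMat V b i j‖ ^ 2 - if i = j then 1 else 0) := by
    have h2 := re_trace_mul_hadamard_self hB (Matrix.of 1)
    rw [of_one_hadamard, spectralMat_mul hV, trace_spectralMat hV, Complex.ofReal_re] at h2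
    simp only [of_apply, Pi.one_apply, Complex.one_re, one_mul] at h2
    simp only [Finset.sum_sub_distrib, ← h2]
    have h3 : ∀ a, (b a - 1) ^ 2 = b a * b a - 2 * b a + 1 := fun a => by ring
    simp only [h3, Finset.sum_add_distrib, Finset.sum_sub_distrib, ← Finset.mul_sum, hsum]
    simp
    ring
  have h4 : g * ∑ a, (b a - 1) ^ 2 ≤ -(spectralMat V b * (γ ⊙ spectralMat V b)).trace.re := by
    rw [hsq, re_trace_mul_hadamard_self hB, Finset.mul_sum, ← Finset.sum_neg_distrib]
    refine Finset.sum_le_sum fun i _ => ?_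
    rw [Finset.mul_sum, ← Finset.sum_neg_distrib]
    refine Finset.sum_le_sum fun j _ => ?_
    by_cases hij : i = j
    · subst hij
      simp [hdiag, hγ.diag_eq_zero]
    · have := mul_le_mul_of_nonneg_right (hγg j i (Ne.symm hij)) (sq_nonneg ‖spectralMat V b i j‖)
      simp only [hij, if_false]
      linarith
  refine h4.trans ?_
  by_cases hd : (d : ℝ) = 0
  · have hd' : d = 0 := by exact_mod_cast hd
    subst hd'
    simp [trace]
  · have hpos : (0 : ℝ) < 2 * d ^ 2 := by positivity
    calc _ = 2 * (d : ℝ) ^ 2 * (1 / (2 * d ^ 2) *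
        -(spectralMat V b * (γ ⊙ spectralMat V b)).trace.re) := by field_simp
      _ ≤ _ := mul_le_mul_of_nonneg_left h1 hpos.le

/-- The inequality between the integrands of the entropy production and of the relative entropy.
With `A = ρ + s` and `D` the diagonal part of `A`, the diagonal matrix `D` commutes with the Schur
multiplier, so `A` may be replaced by `B = D^{-1/2} A D^{-1/2}`, of unit diagonal. -/
theorem integrand_le (hγ : IsSchurGenerator γ) {g : ℝ} (hg : 0 ≤ g)
    (hγg : ∀ i j, i ≠ j → g ≤ -(γ i j).re) (hd : 1 ≤ d) {W : Mat d}
    (hW : Wᴴ * W = 1) (hW' : W * Wᴴ = 1) {r : Fin d → ℝ} (hr : ∀ i, 0 ≤ r i) {s : ℝ} (hs : 0 < s) :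
    g * (∑ a, s / (r a + s) - ∑ i, s / ((spectralMat W r i i).re + s)) ≤
      8 * d ^ 3 * (spectralMat W r * (γ ⊙ spectralMat W (fun a => (r a + s)⁻¹))).trace.re := by
  have hd1 : (1 : ℝ) ≤ d := by exact_mod_cast hd
  set ρ := spectralMat W r with hρ
  have hρpos : ρ.PosSemidef := posSemidef_spectralMat W hr
  have hω : ∀ i, 0 ≤ (ρ i i).re := fun i => (Complex.le_def.1 hρpos.diag_nonneg).1
  have hωre : ∀ i, ρ i i = ((ρ i i).re : ℂ) := fun i => by
    refine Complex.ext rfl ?_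
    simpa using (Complex.le_def.1 hρpos.diag_nonneg).2.symm
  set A := spectralMat W (fun a => r a + s) with hA
  have hA0 : ∀ a, r a + s ≠ 0 := fun a => by have := hr a; positivity
  have hAρ : A = ρ + (s : ℂ) • (1 : Mat d) := by
    rw [hA, ← spectralMat_add, spectralMat_const hW']
  have hAinv : A⁻¹ = spectralMat W (fun a => (r a + s)⁻¹) := spectralMat_inv hW hW' hA0
  have hApos : A.PosDef := by
    rw [hAρ]
    exact PosDef.posSemidef_add hρpos (PosDef.one.smul (by exact_mod_cast hs))
  -- the square roots of the diagonal entries of `A`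
  set D : Fin d → ℝ := fun i => (ρ i i).re + s with hD
  have hDpos : ∀ i, 0 < D i := fun i => by have := hω i; positivity
  set k : Fin d → ℝ := fun i => √(D i) with hk
  have hkpos : ∀ i, 0 < k i := fun i => Real.sqrt_pos.2 (hDpos i)
  have hkk : ∀ i, k i * k i = D i := fun i => Real.mul_self_sqrt (hDpos i).le
  set K : Mat d := diagonal fun i => (k i : ℂ) with hK
  set K' : Mat d := diagonal fun i => ((k i)⁻¹ : ℂ) with hK'
  have hkC : ∀ i, (k i : ℂ) ≠ 0 := fun i => by exact_mod_cast (hkpos i).ne'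
  have hKK' : K * K' = 1 := by
    rw [hK, hK', diagonal_mul_diagonal]
    simp [hkC]
  have hK'K : K' * K = 1 := mul_eq_one_comm.1 hKK'
  set B := K' * A * K' with hB
  have hBinv : B⁻¹ = K * A⁻¹ * K := by
    apply inv_eq_right_inv
    have : B * (K * A⁻¹ * K) = K' * (A * (K' * K) * A⁻¹) * K := by simp only [hB, mul_assoc]
    rw [this, hK'K, mul_one, mul_nonsing_inv _ ((isUnit_iff_isUnit_det _).1 hApos.isUnit), mul_one,
      hK'K]
  have hK'star : K'ᴴ = K' := by
    rw [hK', diagonal_conjTranspose]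
    congr 1
    ext i
    simp
  have hBpos : B.PosDef := by
    have := hApos.mul_mul_conjTranspose_same (B := K') (fun x y hxy => by
      have := congrArg (fun z => z ᵥ* K) hxy
      simpa [vecMul_vecMul, hK'K] using this)
    rwa [hK'star] at this
  have hBij : ∀ i j, B i j = (k i : ℂ)⁻¹ * A i j * (k j : ℂ)⁻¹ := fun i j => by
    rw [hB, hK', mul_diagonal, diagonal_mul]
  have hBinvij : ∀ i j, B⁻¹ i j = k i * A⁻¹ i j * k j := fun i j => by
    rw [hBinv, hK, mul_diagonal, diagonal_mul]
  have hBdiag : ∀ i, B i i = 1 := fun i => by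
    have h1 : A i i = (k i : ℂ) * k i := by
      rw [hAρ]
      simp only [Matrix.add_apply, Matrix.smul_apply, one_apply_eq, smul_eq_mul, mul_one]
      rw [hωre i, ← Complex.ofReal_mul, hkk i]
      simp [hD]
    rw [hBij, h1]
    have := hkC i
    field_simp
  have htr : (ρ * (γ ⊙ A⁻¹)).trace = (B * (γ ⊙ B⁻¹)).trace := by
    simp only [trace, diag_apply, mul_apply, hadamard_apply]
    refine Finset.sum_congr rfl fun i _ => Finset.sum_congr rfl fun j _ => ?_
    by_cases hij : i = j
    · subst hij
      simp [hγ.diag_eq_zero]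
    · have h1 : A i j = ρ i j := by
        rw [hAρ]
        simp [hij]
      rw [hBij, hBinvij, h1]
      have := hkC i
      have := hkC j
      field_simp
  obtain ⟨V, b, hV, hV', hBV⟩ := exists_eq_spectralMat hBpos.isHermitian
  have hb : ∀ i, 0 < b i := pos_of_posDef_spectralMat hV (hBV ▸ hBpos)
  have hmain := hγ.trace_hadamard_inv_ge_of_diag_eq_one hγg hV hV' hb (by rwa [← hBV])
  rw [← hBV, ← htr, hAinv] at hmain
  set q := ∑ a, (b a - 1) ^ 2 with hq
  have hq0 : 0 ≤ q := Finset.sum_nonneg fun _ _ => sq_nonneg _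
  -- `4 d q` covers both regimes: far from `B = 1` the left side is at most `d`, and close to it
  -- `B ≥ 1 / 2` makes the left side quadratic in `B - 1`
  have hle : ∑ a, s / (r a + s) - ∑ i, s / D i ≤ 4 * d * q := by
    by_cases hq4 : 1 / 4 ≤ q
    · have h1 : ∑ a, s / (r a + s) ≤ ∑ _a : Fin d, (1 : ℝ) := by
        refine Finset.sum_le_sum fun a _ => ?_
        have := hr a
        rw [div_le_one (by positivity)]
        linarith
      have h2 : 0 ≤ ∑ i, s / D i := Finset.sum_nonneg fun i _ => (div_pos hs (hDpos i)).le
      simp only [Finset.sum_const, Finset.card_univ, Fintype.card_fin, nsmul_eq_mul, mul_one] at h1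
      nlinarith
    · have hb2 : ∀ a, 1 / 2 ≤ b a := fun a => by
        have h1 : (b a - 1) ^ 2 ≤ q :=
          Finset.single_le_sum (f := fun a => (b a - 1) ^ 2) (fun _ _ => sq_nonneg _)
            (Finset.mem_univ a)
        nlinarith
      -- `N = B⁻¹ - 2 + B = (B - 1) B⁻¹ (B - 1)`
      set N := spectralMat V (fun a => (b a - 1) ^ 2 / b a) with hN
      have hN0 : N.PosSemidef := posSemidef_spectralMat V fun a => by have := hb a; positivity
      have hNdiag : ∀ i, (N i i).re = (B⁻¹ i i).re - 1 := fun i => by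
        have h1 : N + ((2 : ℝ) : ℂ) • (1 : Mat d) = B⁻¹ + B := by
          rw [hBV, spectralMat_inv hV hV' (fun i => (hb i).ne'), ← spectralMat_const hV',
            hN, spectralMat_add, spectralMat_add]
          congr 1
          ext a
          have := (hb a).ne'
          field_simp
          ring
        have h2 := congrArg (fun M : Mat d => (M i i).re) h1
        simp only [Matrix.add_apply, Matrix.smul_apply, one_apply_eq, hBdiag, Complex.add_re] at h2
        simp at h2
        linarith
      have h1 : ∑ a, s / (r a + s) = ∑ i, s / D i * (B⁻¹ i i).re := by
        have h2 : (A⁻¹.trace).re = ∑ a, (r a + s)⁻¹ := by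
          rw [hAinv, trace_spectralMat hW, Complex.ofReal_re]
        simp only [div_eq_mul_inv, ← Finset.mul_sum, mul_assoc]
        rw [← h2, trace, Complex.re_sum]
        congr 1
        refine Finset.sum_congr rfl fun i _ => ?_
        have h3 : B⁻¹ i i = (D i : ℂ) * A⁻¹ i i := by
          rw [hBinvij, ← hkk i]
          push_cast
          ring
        rw [h3, Complex.re_ofReal_mul, inv_mul_cancel_left₀ (hDpos i).ne', diag_apply]
      have h4 : ∑ i, s / D i * (B⁻¹ i i).re - ∑ i, s / D i ≤ ∑ i, (N i i).re := by
        rw [← Finset.sum_sub_distrib]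
        refine Finset.sum_le_sum fun i _ => ?_
        have h5 : 0 ≤ (N i i).re := (Complex.le_def.1 hN0.diag_nonneg).1
        have h6 : s / D i ≤ 1 := by
          rw [div_le_one (hDpos i)]
          have := hω i
          simp only [hD]
          linarith
        have := mul_le_mul_of_nonneg_right h6 h5
        rw [hNdiag] at this ⊢
        linarith
      have h7 : ∑ i, (N i i).re ≤ 2 * q := by
        have : ∑ i, (N i i).re = ∑ a, (b a - 1) ^ 2 / b a := by
          have h8 := trace_spectralMat hV (fun a => (b a - 1) ^ 2 / b a)
          rw [trace] at h8
          have h9 := congrArg Complex.re h8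
          rwa [Complex.re_sum, Complex.ofReal_re] at h9
        rw [this, hq, Finset.mul_sum]
        refine Finset.sum_le_sum fun a _ => ?_
        rw [div_le_iff₀ (hb a)]
        nlinarith [hb2 a, sq_nonneg (b a - 1)]
      rw [h1]
      nlinarith
  calc g * (∑ a, s / (r a + s) - ∑ i, s / D i) ≤ g * (4 * d * q) := by gcongr
    _ = 4 * d * (g * q) := by ring
    _ ≤ 4 * d * (2 * d ^ 2 * _) := by gcongr
    _ = _ := by ring

end IsSchurGenerator

/-! ### From integrands to entropies -/

theorem tendsto_mul_log_add_nhdsGT {x l : ℝ} (h : x = 0 → l = 0) :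
    Tendsto (fun s => l * Real.log (x + s)) (𝓝[>] 0) (𝓝 (l * Real.log x)) := by
  by_cases h0 : x = 0
  · simp [h h0]
  · have h1 : ContinuousAt (fun s => l * Real.log (x + s)) 0 := by
      refine continuousAt_const.mul (ContinuousAt.log (by fun_prop) (by simpa using h0))
    have h2 := h1.tendsto.mono_left (nhdsWithin_le_nhds (s := Set.Ioi 0))
    simpa using h2

theorem tendsto_sum_mul_log_add_atTop {ι : Type*} [Fintype ι] (l x : ι → ℝ) :
    Tendsto (fun s => ∑ i, l i * Real.log (x i + s) - (∑ i, l i) * Real.log s) atTop (𝓝 0) := by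
  have h : Tendsto (fun s => ∑ i, l i * (Real.log (s + x i) - Real.log s)) atTop
      (𝓝 (∑ i, l i * 0)) :=
    tendsto_finsetSum _ fun i _ => (Real.tendsto_log_comp_add_sub_log (x i)).const_mul (l i)
  simp only [mul_zero, Finset.sum_const_zero] at h
  refine h.congr fun s => ?_
  simp only [mul_sub, Finset.sum_sub_distrib, Finset.sum_mul, add_comm]

/-- Since `log x` is the integral over `s > 0` of `1 / (1 + s) - 1 / (x + s)`, an inequality between
resolvents at every `s > 0` integrates to one between entropies. The integration is carried out
by the monotonicity of a primitive that vanishes at infinity. -/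
theorem mul_entropy_le_of_forall_pos {ι : Type*} [Fintype ι] {r ω l : ι → ℝ} {g c : ℝ}
    (hr : ∀ i, 0 ≤ r i) (hω : ∀ i, 0 ≤ ω i) (hrω : ∑ i, r i = ∑ i, ω i) (hl : ∑ i, l i = 0)
    (hrl : ∀ i, r i = 0 → l i = 0)
    (h : ∀ s : ℝ, 0 < s → g * (∑ i, s / (r i + s) - ∑ i, s / (ω i + s)) ≤
      c * ∑ i, l i * (r i + s)⁻¹) :
    g * (∑ i, r i * Real.log (r i) - ∑ i, ω i * Real.log (ω i)) ≤
      c * -∑ i, l i * Real.log (r i) := by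
  set F : ℝ → ℝ := fun s => c * -∑ i, l i * Real.log (r i + s) -
    g * (∑ i, r i * Real.log (r i + s) - ∑ i, ω i * Real.log (ω i + s)) with hF
  have hderiv : ∀ s, 0 < s → HasDerivAt F (c * -∑ i, l i * (r i + s)⁻¹ -
      g * (∑ i, r i * (r i + s)⁻¹ - ∑ i, ω i * (ω i + s)⁻¹)) s := by
    intro s hs
    have hlog : ∀ x, 0 ≤ x → HasDerivAt (fun s => Real.log (x + s)) (x + s)⁻¹ s := by
      intro x hx
      have h1 : HasDerivAt (fun s => x + s) 1 s := (hasDerivAt_id s).const_add x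
      simpa using h1.log (by positivity)
    have hsum : ∀ m x : ι → ℝ, (∀ i, 0 ≤ x i) →
        HasDerivAt (fun s => ∑ i, m i * Real.log (x i + s)) (∑ i, m i * (x i + s)⁻¹) s :=
      fun m x hx => HasDerivAt.fun_sum fun i _ => (hlog (x i) (hx i)).const_mul (m i)
    exact ((hsum l r hr).neg.const_mul c).sub (((hsum r r hr).sub (hsum ω ω hω)).const_mul g)
  have hanti : AntitoneOn F (Set.Ioi 0) := by
    refine antitoneOn_of_hasDerivWithinAt_nonpos (convex_Ioi 0)
      (fun s hs => (hderiv s hs).continuousAt.continuousWithinAt)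
      (fun s hs => (hderiv s (interior_subset hs)).hasDerivWithinAt) fun s hs => ?_
    have hs : 0 < s := by simpa using hs
    have h1 : ∀ x : ι → ℝ, (∀ i, 0 ≤ x i) →
        ∑ i, x i * (x i + s)⁻¹ = Fintype.card ι - ∑ i, s / (x i + s) := by
      intro x hx
      have h2 : ∀ i, x i * (x i + s)⁻¹ = 1 - s / (x i + s) := fun i => by
        have := hx i
        have : x i + s ≠ 0 := by positivity
        field_simp
        ring
      simp [h2]
    rw [h1 r hr, h1 ω hω]
    have := h s hs
    nlinarith
  have htop : Tendsto F atTop (𝓝 0) := by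
    have h1 := ((tendsto_sum_mul_log_add_atTop l r).neg.const_mul c).sub
      (((tendsto_sum_mul_log_add_atTop r r).sub (tendsto_sum_mul_log_add_atTop ω ω)).const_mul g)
    simp only [neg_zero, mul_zero, sub_zero] at h1
    refine h1.congr fun s => ?_
    rw [hl, hrω, hF]
    ring
  have hnonneg : ∀ s, 0 < s → 0 ≤ F s := by
    intro s hs
    refine le_of_tendsto htop ?_
    filter_upwards [eventually_ge_atTop s] with t ht
    exact hanti hs (hs.trans_le ht) ht
  have hzero : Tendsto F (𝓝[>] 0) (𝓝 (c * -∑ i, l i * Real.log (r i) -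
      g * (∑ i, r i * Real.log (r i) - ∑ i, ω i * Real.log (ω i)))) := by
    have hsum : ∀ m x : ι → ℝ, (∀ i, x i = 0 → m i = 0) →
        Tendsto (fun s => ∑ i, m i * Real.log (x i + s)) (𝓝[>] 0)
          (𝓝 (∑ i, m i * Real.log (x i))) :=
      fun m x hm => tendsto_finsetSum _ fun i _ => tendsto_mul_log_add_nhdsGT (hm i)
    exact ((hsum l r hrl).neg.const_mul c).sub
      (((hsum r r fun _ => id).sub (hsum ω ω fun _ => id)).const_mul g)
  have := ge_of_tendsto hzero (by
    filter_upwards [self_mem_nhdsWithin] with s hs using hnonneg s hs)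
  linarith

theorem trace_mul_hadamard_transpose (γ X Y : Mat d) :
    (X * (γ ⊙ Y)).trace = ((γᵀ ⊙ X) * Y).trace := by
  simp only [trace, diag_apply, mul_apply, hadamard_apply, transpose_apply]
  refine Finset.sum_congr rfl fun i _ => Finset.sum_congr rfl fun j _ => ?_
  ring

/-- The entropy inequality for the dual Schur multiplier semigroup, generated by `γᵀ`, in terms of
the eigenvalues `r` of a positive matrix and of its diagonal entries. -/
theorem IsSchurGenerator.mul_entropy_le {γ : Mat d} (hγ : IsSchurGenerator γ) {g : ℝ} (hg : 0 ≤ g)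
    (hγg : ∀ i j, i ≠ j → g ≤ -(γ i j).re) (hd : 1 ≤ d) {W : Mat d}
    (hW : Wᴴ * W = 1) (hW' : W * Wᴴ = 1) {r : Fin d → ℝ} (hr : ∀ i, 0 ≤ r i)
    (hker : ∀ a, r a = 0 → star (W.col a) ⬝ᵥ ((γᵀ ⊙ spectralMat W r) *ᵥ W.col a) = 0) :
    g * (∑ a, r a * Real.log (r a) -
        ∑ i, (spectralMat W r i i).re * Real.log (spectralMat W r i i).re) ≤
      8 * d ^ 3 * -((γᵀ ⊙ spectralMat W r) * spectralMat W fun a => Real.log (r a)).trace.re := by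
  set l : Fin d → ℝ := fun a => (star (W.col a) ⬝ᵥ ((γᵀ ⊙ spectralMat W r) *ᵥ W.col a)).re with hl
  have htr : ∀ f : Fin d → ℝ,
      ((γᵀ ⊙ spectralMat W r) * spectralMat W f).trace.re = ∑ a, l a * f a := by
    intro f
    rw [trace_mul_spectralMat, Complex.re_sum]
    refine Finset.sum_congr rfl fun a _ => ?_
    rw [Complex.re_ofReal_mul, hl, mul_comm]
  rw [htr]
  refine mul_entropy_le_of_forall_pos hr
    (fun i => (Complex.le_def.1 (posSemidef_spectralMat W hr).diag_nonneg).1) ?_ ?_ ?_ ?_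
  · have h := congrArg Complex.re (trace_spectralMat hW r)
    rw [trace, Complex.re_sum, Complex.ofReal_re] at h
    exact h.symm
  · have h := htr fun _ => 1
    rw [spectralMat_const hW', Complex.ofReal_one, one_smul, mul_one] at h
    simpa [trace, hγ.diag_eq_zero] using h.symm
  · intro a ha
    simp [hl, hker a ha]
  · intro s hs
    rw [← htr, ← trace_mul_hadamard_transpose]
    exact hγ.integrand_le hg hγg hd hW hW' hr hs

/-- Pinching strictly increases the entropy of a matrix that is not diagonal. -/
theorem entropy_diag_lt {W : Mat d} (hW : Wᴴ * W = 1) (hW' : W * Wᴴ = 1) {r : Fin d → ℝ}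
    (hr : ∀ i, 0 ≤ r i) (hdiag : (1 : Mat d) ⊙ spectralMat W r ≠ spectralMat W r) :
    ∑ i, (spectralMat W r i i).re * Real.log (spectralMat W r i i).re <
      ∑ a, r a * Real.log (r a) := by
  set u : Fin d → Fin d → ℝ := fun i a => ‖W i a‖ ^ 2 with hu
  have hu0 : ∀ i a, 0 ≤ u i a := fun i a => sq_nonneg _
  have hmulconj : ∀ i a, W i a * star (W i a) = (u i a : ℂ) := fun i a => by
    rw [Complex.star_def, Complex.mul_conj, Complex.normSq_eq_norm_sq]
  have hentry : ∀ i j, spectralMat W r i j = ∑ a, W i a * r a * star (W j a) := fun i j => by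
    simp [spectralMat, mul_apply, diagonal_apply]
  have hu1 : ∀ i, ∑ a, u i a = 1 := fun i => by
    have h := congrFun (congrFun hW' i) i
    simp only [mul_apply, conjTranspose_apply, hmulconj, one_apply_eq] at h
    exact_mod_cast h
  have hu2 : ∀ a, ∑ i, u i a = 1 := fun a => by
    have h := congrFun (congrFun hW a) a
    simp only [mul_apply, conjTranspose_apply, one_apply_eq, mul_comm (star (W _ a)),
      hmulconj] at h
    exact_mod_cast h
  have hω : ∀ i, (spectralMat W r i i).re = ∑ a, u i a • r a := fun i => by
    rw [hentry, Complex.re_sum]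
    refine Finset.sum_congr rfl fun a _ => ?_
    rw [mul_right_comm, hmulconj, ← Complex.ofReal_mul, Complex.ofReal_re, smul_eq_mul]
  have hconv := Real.strictConvexOn_mul_log
  have hle : ∀ i, (∑ a, u i a • r a) * Real.log (∑ a, u i a • r a) ≤
      ∑ a, u i a • (r a * Real.log (r a)) := fun i =>
    hconv.convexOn.map_sum_le (fun a _ => hu0 i a) (hu1 i) (fun a _ => hr a)
  have hsum : ∑ a, r a * Real.log (r a) = ∑ i, ∑ a, u i a • (r a * Real.log (r a)) := by
    rw [Finset.sum_comm]
    refine Finset.sum_congr rfl fun a _ => ?_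
    rw [← Finset.sum_smul, hu2, one_smul]
  simp only [hω]
  rw [hsum]
  refine lt_of_le_of_ne (Finset.sum_le_sum fun i _ => hle i) fun heq => hdiag ?_
  have heq' := (Finset.sum_eq_sum_iff_of_le fun i _ => hle i).1 heq
  -- equality in Jensen's inequality: `r` is constant on the support of each row of `W`
  have hconst : ∀ i a, W i a ≠ 0 → r a = ∑ a, u i a • r a := fun i a hia =>
    (hconv.map_sum_eq_iff' (fun a _ => hu0 i a) (hu1 i) (fun a _ => hr a)).1
      (heq' i (Finset.mem_univ i)) a (Finset.mem_univ a) (by simp [hu, hia])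
  rw [one_hadamard]
  ext i j
  by_cases hij : i = j
  · subst hij
    simp
  · rw [diagonal_apply_ne _ hij, hentry]
    have h := congrFun (congrFun hW' i) j
    simp only [mul_apply, conjTranspose_apply, one_apply_ne hij] at h
    have h1 : ∀ a, W i a * r a * star (W j a) =
        ((∑ a, u i a • r a : ℝ) : ℂ) * (W i a * star (W j a)) := fun a => by
      by_cases hia : W i a = 0
      · simp [hia]
      · rw [hconst i a hia]
        ring
    rw [Finset.sum_congr rfl fun a _ => h1 a, ← Finset.mul_sum, h, mul_zero]

/-! ### Continuous one-parameter semigroups of complex numbers -/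

/-- A continuous solution of `p (s + t) = p s * p t` on `[0, ∞)` is smoothed by integration over a
short interval, hence differentiable, hence an exponential. -/
theorem exists_eq_exp_of_continuous {p : ℝ≥0 → ℂ} (hc : Continuous p) (h0 : p 0 = 1)
    (hadd : ∀ s t, p (s + t) = p s * p t) :
    ∃ c : ℂ, ∀ t : ℝ≥0, p t = Complex.exp ((t : ℝ) * c) := by
  set q : ℝ → ℂ := fun t => p t.toNNReal with hq
  have hqc : Continuous q := hc.comp continuous_real_toNNReal
  have hq0 : q 0 = 1 := by simp [hq, h0]
  have hqadd : ∀ s t : ℝ, 0 ≤ s → 0 ≤ t → q (s + t) = q s * q t := fun s t hs ht => by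
    simp only [hq, Real.toNNReal_add hs ht, hadd]
  set F : ℝ → ℂ := fun x => ∫ u in (0 : ℝ)..x, q u with hF
  have hFd : ∀ x, HasDerivAt F (q x) x := fun x =>
    intervalIntegral.integral_hasDerivAt_right (hqc.intervalIntegrable _ _)
      hqc.stronglyMeasurable.stronglyMeasurableAtFilter hqc.continuousAt
  obtain ⟨a, ha, hFa⟩ : ∃ a, 0 < a ∧ F a ≠ 0 := by
    have h1 : ∀ᶠ x in 𝓝[≠] (0 : ℝ), F x ≠ 0 := (hFd 0).eventually_ne (by simp [hq0])
    have h2 : ∀ᶠ x in 𝓝[>] (0 : ℝ), F x ≠ 0 :=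
      h1.filter_mono (nhdsWithin_mono _ fun x (hx : 0 < x) => hx.ne')
    obtain ⟨a, ha, h⟩ := (h2.and self_mem_nhdsWithin).exists
    exact ⟨a, h, ha⟩
  -- on `[0, ∞)`, `q` agrees with a differentiable function
  have hqF : ∀ t, 0 ≤ t → q t = (F (t + a) - F t) / F a := by
    intro t ht
    rw [eq_div_iff hFa]
    have h1 : F (t + a) - F t = ∫ u in t..(t + a), q u :=
      intervalIntegral.integral_interval_sub_left (hqc.intervalIntegrable _ _)
        (hqc.intervalIntegrable _ _)
    have h2 : ∫ u in (0 : ℝ)..a, q (t + u) = ∫ u in t..(t + a), q u := by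
      simp
    rw [h1, ← h2, hF]
    simp only
    rw [← intervalIntegral.integral_const_mul]
    refine intervalIntegral.integral_congr fun u hu => ?_
    rw [Set.uIcc_of_le ha.le] at hu
    exact (hqadd t u ht hu.1).symm
  set c : ℂ := (q (0 + a) - q 0) / F a with hcdef
  have hG : HasDerivAt (fun t => (F (t + a) - F t) / F a) c 0 := by
    have h1 : HasDerivAt (fun t => F (t + a)) (q (0 + a)) 0 := (hFd (0 + a)).comp_add_const 0 a
    exact (h1.sub (hFd 0)).div_const _
  have hqr0 : HasDerivWithinAt q c (Set.Ici 0) 0 :=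
    hG.hasDerivWithinAt.congr (fun t ht => hqF t ht) (hqF 0 le_rfl)
  have hqr : ∀ t, 0 ≤ t → HasDerivWithinAt q (q t * c) (Set.Ici t) t := by
    intro t ht
    have h1 : HasDerivWithinAt (fun x => q (x - t)) c (Set.Ici t) t := by
      have h2 : HasDerivWithinAt (fun x : ℝ => x - t) 1 (Set.Ici t) t :=
        ((hasDerivAt_id t).sub_const t).hasDerivWithinAt
      have h3 : HasDerivWithinAt q c (Set.Ici 0) (t - t) := by simpa using hqr0
      have h4 := HasDerivWithinAt.scomp (h := fun x : ℝ => x - t) t h3 h2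
        (fun x (hx : t ≤ x) => sub_nonneg.2 hx)
      simpa [Function.comp_def] using h4
    refine (h1.const_mul (q t)).congr (fun x hx => ?_) (by simp [hq0])
    rw [← hqadd t (x - t) ht (by simpa using hx)]
    congr 1
    ring
  refine ⟨c, fun t => ?_⟩
  have hconst := constant_of_has_deriv_right_zero (f := fun s : ℝ => q s * Complex.exp (-(s * c)))
    (a := 0) (b := t) (by fun_prop) (fun s hs => by
      have h1 : HasDerivAt (fun s : ℝ => Complex.exp (-((s : ℂ) * c)))
          (Complex.exp (-((s : ℂ) * c)) * (-(1 * c))) s :=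
        (((Complex.ofRealCLM.hasDerivAt (x := s)).mul_const c).neg).cexp
      have h2 := (hqr s hs.1).mul h1.hasDerivWithinAt
      have h3 : q s * c * Complex.exp (-((s : ℂ) * c)) +
          q s * (Complex.exp (-((s : ℂ) * c)) * (-(1 * c))) = 0 := by ring
      rw [h3] at h2
      exact h2) t ⟨t.2, le_rfl⟩
  simp only [hq0, Complex.ofReal_zero, zero_mul, neg_zero, Complex.exp_zero, mul_one] at hconst
  have h3 : q t = p t := by simp [hq]
  rw [h3, Complex.exp_neg] at hconst
  exact (mul_inv_eq_one₀ (Complex.exp_ne_zero _)).1 hconst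

/-! ### Schur multipliers in an orthonormal basis -/

/-- The unitary matrix whose columns are the vectors of the orthonormal basis. -/
def basisMat (e : OrthonormalBasis (Fin d) ℂ (EuclideanSpace ℂ (Fin d))) : Mat d :=
  Matrix.of fun a j => e j a

section basisMat

variable (e : OrthonormalBasis (Fin d) ℂ (EuclideanSpace ℂ (Fin d)))

theorem conjTranspose_mul_basisMat : (basisMat e)ᴴ * basisMat e = 1 := by
  ext i j
  have h := orthonormal_iff_ite.1 e.orthonormal i j
  rw [PiLp.inner_apply] at h
  simp only [mul_apply, conjTranspose_apply, basisMat, of_apply, one_apply, ← h]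
  refine Finset.sum_congr rfl fun a _ => ?_
  simp [mul_comm]

theorem basisMat_mul_conjTranspose : basisMat e * (basisMat e)ᴴ = 1 :=
  mul_eq_one_comm.1 (conjTranspose_mul_basisMat e)

theorem ketBra_eq (i j : Fin d) :
    ketBra e i j = basisMat e * single i j 1 * (basisMat e)ᴴ := by
  ext a b
  simp [ketBra, vecMulVec_apply, basisMat, mul_apply, single_apply, ite_and]

theorem mem_diagonalAlgebra_iff {X : Mat d} :
    X ∈ diagonalAlgebra e ↔ ∃ x : Fin d → ℂ, X = basisMat e * diagonal x * (basisMat e)ᴴ := by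
  have h : ∀ x : Fin d → ℂ, ∑ i, x i • ketBra e i i =
      basisMat e * diagonal x * (basisMat e)ᴴ := by
    intro x
    have h1 : diagonal x = ∑ i, x i • single i i (1 : ℂ) := by
      ext a b
      rw [Matrix.sum_apply]
      by_cases hab : a = b
      · subst hab
        simp [single_apply]
      · rw [diagonal_apply_ne _ hab, Finset.sum_eq_zero]
        intro i _
        rw [Matrix.smul_apply, single_apply, if_neg, smul_zero]
        rintro ⟨rfl, rfl⟩
        exact hab rfl
    simp only [h1, ketBra_eq, Finset.mul_sum, Finset.sum_mul, mul_smul_comm, smul_mul_assoc]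
  simp only [diagonalAlgebra, Set.mem_ofPred_eq, h]

end basisMat

/-- The linear map whose matrix entries in the basis of the columns of `U` are multiplied by `g`. -/
def schurMap (U g : Mat d) : Mat d →ₗ[ℂ] Mat d where
  toFun X := U * (g ⊙ (Uᴴ * X * U)) * Uᴴ
  map_add' X Y := by simp only [mul_add, add_mul, hadamard_add]
  map_smul' c X := by simp only [mul_smul_comm, smul_mul_assoc, hadamard_smul, RingHom.id_apply]

theorem schurMap_apply (U g X : Mat d) : schurMap U g X = U * (g ⊙ (Uᴴ * X * U)) * Uᴴ := rfl

theorem conj_conj_cancel {U : Mat d} (hU : Uᴴ * U = 1) (X : Mat d) :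
    Uᴴ * (U * X * Uᴴ) * U = X := by
  have : Uᴴ * (U * X * Uᴴ) * U = (Uᴴ * U) * X * (Uᴴ * U) := by simp only [mul_assoc]
  rw [this, hU, one_mul, mul_one]

theorem conj_conj_cancel' {U : Mat d} (hU' : U * Uᴴ = 1) (X : Mat d) :
    U * (Uᴴ * X * U) * Uᴴ = X := by
  have : U * (Uᴴ * X * U) * Uᴴ = (U * Uᴴ) * X * (U * Uᴴ) := by simp only [mul_assoc]
  rw [this, hU', one_mul, mul_one]

theorem schurMap_conj {U : Mat d} (hU : Uᴴ * U = 1) (g X : Mat d) :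
    schurMap U g (U * X * Uᴴ) = U * (g ⊙ X) * Uᴴ := by
  rw [schurMap_apply, conj_conj_cancel hU]

/-! ### The semigroup acts by Schur multipliers -/

theorem IsCompletelyPositive.posSemidef {Φ : Mat d →ₗ[ℂ] Mat d} (hΦ : IsCompletelyPositive Φ)
    {X : Mat d} (hX : X.PosSemidef) : (Φ X).PosSemidef :=
  (hΦ 1 _ (hX.submatrix (Prod.snd : Fin 1 × Fin d → Fin d))).submatrix
    (fun i => ((0 : Fin 1), i))

namespace QMS

theorem continuous_det_map (P : QMS d) : Continuous fun t => LinearMap.det (P.map t) := by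
  have h : ∀ t, LinearMap.det (P.map t) =
      (LinearMap.toMatrix (Matrix.stdBasis ℂ (Fin d) (Fin d)) (Matrix.stdBasis ℂ (Fin d) (Fin d))
        (P.map t)).det := fun t => (LinearMap.det_toMatrix _ _).symm
  simp only [h]
  refine Continuous.matrix_det (continuous_matrix fun i j => ?_)
  simp only [LinearMap.toMatrix_apply]
  have h2 : Continuous ((Matrix.stdBasis ℂ (Fin d) (Fin d)).coord i) :=
    LinearMap.continuous_of_finiteDimensional _
  exact h2.comp (P.continuous_map _)

theorem map_natCast_mul (P : QMS d) (n : ℕ) (s : ℝ≥0) : P.map (n * s) = P.map s ^ n := by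
  induction n with
  | zero => rw [Nat.cast_zero, zero_mul, P.map_zero, pow_zero, Module.End.one_eq_id]
  | succ n ih =>
    rw [Nat.cast_succ, add_mul, one_mul, P.map_add, ih, pow_succ, Module.End.mul_eq_comp]

/-- `P_t` is a power of `P_{t/n}`, which is close to the identity for large `n`. -/
theorem det_map_ne_zero (P : QMS d) (t : ℝ≥0) : LinearMap.det (P.map t) ≠ 0 := by
  have h0 : ∀ᶠ s in 𝓝 (0 : ℝ≥0), LinearMap.det (P.map s) ≠ 0 := by
    refine P.continuous_det_map.continuousAt.eventually_ne ?_
    rw [P.map_zero, LinearMap.det_id]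
    exact one_ne_zero
  have hlim : Tendsto (fun n : ℕ => t / (n : ℝ≥0)) atTop (𝓝 0) := by
    simpa [div_eq_mul_inv] using
      (tendsto_inv_atTop_nhds_zero_nat (𝕜 := ℝ≥0)).const_mul t
  obtain ⟨n, hn, hn0⟩ := ((hlim.eventually h0).and (eventually_gt_atTop 0)).exists
  have h1 : (n : ℝ≥0) * (t / n) = t := mul_div_cancel₀ t (Nat.cast_ne_zero.2 hn0.ne')
  rw [← h1, map_natCast_mul, map_pow]
  exact pow_ne_zero _ hn

theorem map_surjective (P : QMS d) (t : ℝ≥0) : Function.Surjective (P.map t) :=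
  (LinearMap.equivOfDetNeZero (P.map t) (P.det_map_ne_zero t)).surjective

theorem map_mem_dfAlgebra (P : QMS d) {X : Mat d} (hX : X ∈ P.dfAlgebra) (s : ℝ≥0) :
    P.map s X ∈ P.dfAlgebra := by
  have hmap : ∀ t Z, P.map t (P.map s Z) = P.map (t + s) Z := fun t Z => by rw [P.map_add]; rfl
  intro t Y
  obtain ⟨Y, rfl⟩ := P.map_surjective s Y
  rw [← (hX s Y).1, ← (hX s Y).2]
  simp only [hmap, (hX (t + s) Y).1, (hX (t + s) Y).2, and_self]

section diagonal

variable {P : QMS d} {e : OrthonormalBasis (Fin d) ℂ (EuclideanSpace ℂ (Fin d))}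

theorem ketBra_self_mem (hN : P.dfAlgebra = diagonalAlgebra e) (i : Fin d) :
    ketBra e i i ∈ P.dfAlgebra := by
  rw [hN]
  refine ⟨Pi.single i 1, ?_⟩
  simp [Pi.single_apply]

theorem conjTranspose_ketBra_self (e : OrthonormalBasis (Fin d) ℂ (EuclideanSpace ℂ (Fin d)))
    (i : Fin d) : (ketBra e i i)ᴴ = ketBra e i i := by
  simp [ketBra_eq, mul_assoc]

theorem ketBra_mul_self (e : OrthonormalBasis (Fin d) ℂ (EuclideanSpace ℂ (Fin d)))
    (i : Fin d) : ketBra e i i * ketBra e i i = ketBra e i i := by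
  have h := conjTranspose_mul_basisMat e
  have : ketBra e i i * ketBra e i i = basisMat e * (single i i 1 * ((basisMat e)ᴴ * basisMat e) *
      single i i 1) * (basisMat e)ᴴ := by
    simp only [ketBra_eq, mul_assoc]
  rw [this, h, mul_one, single_mul_single_same, mul_one, ketBra_eq]

/-- The diagonal projections `|e_i⟩⟨e_i|` are fixed: they evolve continuously among the projections
of a finite-dimensional commutative algebra. -/
theorem map_ketBra_self (hN : P.dfAlgebra = diagonalAlgebra e) (t : ℝ≥0) (i : Fin d) :
    P.map t (ketBra e i i) = ketBra e i i := by
  set U := basisMat e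
  have hU := conjTranspose_mul_basisMat e
  have hmem := ketBra_self_mem hN i
  have hidem : ∀ t, (P.map t (ketBra e i i))ᴴ * P.map t (ketBra e i i) =
      P.map t (ketBra e i i) := fun t => by
    rw [← (hmem t _).1, conjTranspose_ketBra_self, ketBra_mul_self]
  have hdiag : ∀ t, ∃ x : Fin d → ℂ, P.map t (ketBra e i i) = U * diagonal x * Uᴴ := fun t => by
    rw [← mem_diagonalAlgebra_iff, ← hN]
    exact P.map_mem_dfAlgebra hmem t
  choose x hx using hdiag
  have hx' : ∀ t k, x t k = (Uᴴ * P.map t (ketBra e i i) * U) k k := fun t k => by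
    rw [hx, conj_conj_cancel hU, diagonal_apply_eq]
  have hx01 : ∀ t k, x t k = 0 ∨ x t k = 1 := by
    intro t k
    have h1 : diagonal (fun k => star (x t k) * x t k) = diagonal (x t) := by
      rw [← conj_conj_cancel hU (diagonal fun k => star (x t k) * x t k),
        ← conj_conj_cancel hU (diagonal (x t)), ← hx, ← hidem t, hx]
      congr 2
      simp only [conjTranspose_mul, conjTranspose_conjTranspose, diagonal_conjTranspose]
      have : U * (diagonal (star (x t)) * Uᴴ) * (U * diagonal (x t) * Uᴴ) =
          U * (diagonal (star (x t)) * (Uᴴ * U) * diagonal (x t)) * Uᴴ := by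
        simp only [mul_assoc]
      rw [this, hU, mul_one, diagonal_mul_diagonal]
      rfl
    have h2 : star (x t k) * x t k = x t k := by
      simpa using congrFun (congrFun h1 k) k
    by_cases h0 : x t k = 0
    · exact Or.inl h0
    · right
      have h3 : star (x t k) = 1 := by
        have := mul_right_cancel₀ h0 (h2.trans (one_mul _).symm)
        exact this
      simpa using congrArg star h3
  have hconst : ∀ k, x t k = x 0 k := by
    intro k
    have hc : Continuous fun t => x t k := by
      simp only [hx']
      have h1 : Continuous fun t => Uᴴ * P.map t (ketBra e i i) * U :=
        (continuous_const.matrix_mul (P.continuous_map _)).matrix_mul continuous_const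
      exact h1.matrix_elem k k
    have hfin : ({0, 1} : Set ℂ).Finite := by simp
    obtain ⟨y, -, h⟩ := isPreconnected_univ.eqOn_const_of_mapsTo hfin.isDiscrete hc.continuousOn
      (fun t _ => by simpa using hx01 t k) ⟨0, by simp⟩
    exact (h (Set.mem_univ t)).trans (h (Set.mem_univ 0)).symm
  rw [hx t, funext hconst, ← hx 0, P.map_zero]
  rfl

theorem single_mul_mul_single_one (M : Mat d) (i j : Fin d) :
    single i i (1 : ℂ) * M * single j j (1 : ℂ) = M i j • single i j (1 : ℂ) := by
  ext a b
  simp only [mul_apply, single_apply, Matrix.smul_apply, smul_eq_mul]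
  by_cases ha : i = a <;> by_cases hb : j = b <;> simp [ha, hb]

theorem exists_map_eq_schurMap (hN : P.dfAlgebra = diagonalAlgebra e) :
    ∃ p : ℝ≥0 → Mat d, ∀ t, P.map t = schurMap (basisMat e) (p t) := by
  set U := basisMat e with hUdef
  have hU := conjTranspose_mul_basisMat e
  have hU' := basisMat_mul_conjTranspose e
  refine ⟨fun t => Matrix.of fun i j => (Uᴴ * P.map t (ketBra e i j) * U) i j, fun t => ?_⟩
  have hfix := map_ketBra_self (P := P) hN t
  have hstar := conjTranspose_ketBra_self e
  -- `|e_i⟩⟨e_i|` is decoherence-free and fixed, so it can be pulled out of `P_t` on either side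
  have hcut : ∀ X i j, P.map t (ketBra e i i * X * ketBra e j j) =
      ketBra e i i * P.map t X * ketBra e j j := by
    intro X i j
    have h1 := (ketBra_self_mem hN j t (ketBra e i i * X)).2
    have h2 := (ketBra_self_mem hN i t X).1
    rw [hstar, hfix, hstar] at h1 h2
    rw [h1, h2]
  have hexp : ∀ X i j, ketBra e i i * X * ketBra e j j = (Uᴴ * X * U) i j • ketBra e i j := by
    intro X i j
    have : ketBra e i i * X * ketBra e j j =
        U * (single i i 1 * (Uᴴ * X * U) * single j j 1) * Uᴴ := by
      simp only [ketBra_eq, mul_assoc, ← hUdef]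
    rw [this, single_mul_mul_single_one, ketBra_eq, mul_smul_comm, smul_mul_assoc]
  ext1 X
  rw [← conj_conj_cancel' hU' (P.map t X), schurMap_apply]
  congr 2
  ext i j
  have h := hcut X i j
  rw [hexp, hexp, map_smul] at h
  have h2 := congrArg (fun Z => (Uᴴ * Z * U) i j) h
  simp only [mul_smul_comm, smul_mul_assoc, Matrix.smul_apply, smul_eq_mul] at h2
  rw [ketBra_eq e i j, conj_conj_cancel hU, single_apply_same, mul_one, ← ketBra_eq] at h2
  exact h2.symm.trans (mul_comm _ _)

/-- In a Gram matrix of unit vectors, an entry of modulus at least `1` means that two of the vectors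
are proportional: `x = e_j - p_ij e_i` lies in the kernel of `p`. -/
theorem mul_eq_of_one_le_norm {p : Mat d} (hp : IsSchurMultiplier p) {i j : Fin d}
    (h : 1 ≤ ‖p i j‖) (k : Fin d) : p k j = p k i * p i j := by
  have hone : (Matrix.of fun _ _ => 1 : Mat d).PosSemidef := by
    simpa [vecMulVec, Pi.star_def] using posSemidef_vecMulVec_self_star (fun _ : Fin d => (1 : ℂ))
  have hpos : p.PosSemidef := by
    have := hp.posSemidef _ hone
    have h2 : p ⊙ (Matrix.of fun _ _ => 1 : Mat d) = p := by
      ext a b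
      simp
    rwa [h2] at this
  by_cases hij : i = j
  · subst hij
    simp [hp.diag_eq_one]
  set v : Fin d → ℂ := Pi.single j 1 - p i j • Pi.single i 1 with hv
  have hpv : ∀ k, (p *ᵥ v) k = p k j - p k i * p i j := fun k => by
    simp [hv, mulVec_sub, mulVec_smul, mul_comm]
  have hval : star v ⬝ᵥ (p *ᵥ v) = ((1 - ‖p i j‖ ^ 2 : ℝ) : ℂ) := by
    have h1 : star v ⬝ᵥ (p *ᵥ v) = (p *ᵥ v) j - star (p i j) * (p *ᵥ v) i := by
      have h2 : star v = Pi.single j 1 - star (p i j) • Pi.single i 1 := by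
        rw [hv, star_sub, star_smul, ← Pi.single_star, ← Pi.single_star, star_one]
      rw [h2, sub_dotProduct, smul_dotProduct]
      simp
    have h3 : p j i = star (p i j) := (hpos.isHermitian.apply j i).symm
    rw [h1, hpv, hpv, hp.diag_eq_one, hp.diag_eq_one, h3, one_mul, sub_self, mul_zero, sub_zero,
      mul_comm, Complex.star_def, Complex.mul_conj, Complex.normSq_eq_norm_sq]
    push_cast
    rfl
  have hnn := hpos.dotProduct_mulVec_nonneg v
  have hzero : star v ⬝ᵥ (p *ᵥ v) = 0 := by
    rw [hval] at hnn ⊢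
    have h4 : 0 ≤ 1 - ‖p i j‖ ^ 2 := by exact_mod_cast hnn
    have h5 : 1 - ‖p i j‖ ^ 2 = 0 := by nlinarith
    rw [h5, Complex.ofReal_zero]
  have h6 := (hpos.dotProduct_mulVec_zero_iff v).1 hzero
  have h7 := congrFun h6 k
  rw [hpv] at h7
  exact sub_eq_zero.1 h7

theorem isSchurMultiplier_of_map_eq {t : ℝ≥0} {p : Mat d}
    (h : P.map t = schurMap (basisMat e) p) : IsSchurMultiplier p := by
  have hU := conjTranspose_mul_basisMat e
  constructor
  · intro i
    have h1 := P.unital t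
    rw [h] at h1
    have h2 := congrArg (fun Z => ((basisMat e)ᴴ * Z * basisMat e) i i) h1
    simp only [schurMap_apply, mul_one, hU, conj_conj_cancel hU, hadamard_apply, one_apply_eq] at h2
    exact h2
  · intro X hX
    have h1 := (P.completelyPositive t).posSemidef (hX.mul_mul_conjTranspose_same (basisMat e))
    rw [h, schurMap_conj hU] at h1
    have h2 := h1.conjTranspose_mul_mul_same (basisMat e)
    rwa [conj_conj_cancel hU] at h2

/-- A semigroup whose decoherence-free algebra is diagonal acts by Schur multipliers
`exp (t γ_ij)`, with strict decay off the diagonal. -/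
theorem exists_schurGenerator (hN : P.dfAlgebra = diagonalAlgebra e) :
    ∃ γ : Mat d, IsSchurGenerator γ ∧ (∀ i j, i ≠ j → (γ i j).re < 0) ∧
      ∀ t : ℝ≥0, P.map t = schurMap (basisMat e) (expMultiplier γ t) := by
  obtain ⟨p, hp⟩ := exists_map_eq_schurMap hN
  set U := basisMat e with hUdef
  have hU : Uᴴ * U = 1 := conjTranspose_mul_basisMat e
  have hU' : U * Uᴴ = 1 := basisMat_mul_conjTranspose e
  have hmult : ∀ t, IsSchurMultiplier (p t) := fun t => isSchurMultiplier_of_map_eq (hp t)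
  have hentry : ∀ t i j, p t i j = (Uᴴ * P.map t (ketBra e i j) * U) i j := fun t i j => by
    rw [hp, ketBra_eq, schurMap_conj hU, conj_conj_cancel hU]
    simp
  have hcont : ∀ i j, Continuous fun t => p t i j := fun i j => by
    simp only [hentry]
    exact ((continuous_const.matrix_mul (P.continuous_map _)).matrix_mul
      continuous_const).matrix_elem i j
  have hzero : ∀ i j, p 0 i j = 1 := fun i j => by
    rw [hentry, P.map_zero, LinearMap.id_apply, ketBra_eq, conj_conj_cancel hU, single_apply_same]
  have hadd : ∀ i j s t, p (s + t) i j = p s i j * p t i j := fun i j s t => by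
    rw [hentry, P.map_add, LinearMap.comp_apply, hp t, ketBra_eq, schurMap_conj hU, hp s,
      schurMap_conj hU, conj_conj_cancel hU]
    simp
  have hc : ∀ i j, ∃ c : ℂ, (i = j → c = 0) ∧ ∀ t : ℝ≥0, p t i j = Complex.exp ((t : ℝ) * c) := by
    intro i j
    by_cases hij : i = j
    · subst hij
      exact ⟨0, fun _ => rfl, fun t => by simp [(hmult t).diag_eq_one]⟩
    · obtain ⟨c, hc⟩ := exists_eq_exp_of_continuous (hcont i j) (hzero i j) (hadd i j)
      exact ⟨c, fun h => absurd h hij, hc⟩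
  choose γ hγ0 hγ using hc
  have hpγ : ∀ t : ℝ≥0, expMultiplier (Matrix.of γ) t = p t := fun t => by
    ext i j
    simp [expMultiplier, hγ]
  refine ⟨Matrix.of γ, ⟨fun i => hγ0 i i rfl, fun t ht => ?_⟩, fun i j hij => ?_, fun t => ?_⟩
  · have := hpγ ⟨t, ht⟩
    change expMultiplier (Matrix.of γ) t = _ at this
    rw [this]
    exact hmult _
  · by_contra hre
    have hre : 0 ≤ (γ i j).re := not_lt.1 hre
    have hnorm : ∀ t, 1 ≤ ‖p t i j‖ := fun t => by
      rw [hγ, Complex.norm_exp, Real.one_le_exp_iff, Complex.re_ofReal_mul]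
      positivity
    have hherm : ∀ t a b, star (p t a b) = p t b a := fun t a b => by
      have hone : (Matrix.of fun _ _ => 1 : Mat d).PosSemidef := by
        simpa [vecMulVec, Pi.star_def] using
          posSemidef_vecMulVec_self_star (fun _ : Fin d => (1 : ℂ))
      simpa using ((hmult t).posSemidef _ hone).isHermitian.apply b a
    -- `|e_i⟩⟨e_j|` is then decoherence-free, but it is not diagonal
    have hmem : ketBra e i j ∈ P.dfAlgebra := by
      intro t Y
      have hk := mul_eq_of_one_le_norm (hmult t) (hnorm t)
      have hY : Y = U * (Uᴴ * Y * U) * Uᴴ := (conj_conj_cancel' hU' Y).symm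
      set Z := Uᴴ * Y * U
      have hmul : ∀ A B : Mat d, (U * A * Uᴴ) * (U * B * Uᴴ) = U * (A * B) * Uᴴ := fun A B => by
        have : (U * A * Uᴴ) * (U * B * Uᴴ) = U * (A * (Uᴴ * U) * B) * Uᴴ := by
          simp only [mul_assoc]
        rw [this, hU, mul_one]
      have hst : ∀ A : Mat d, (U * A * Uᴴ)ᴴ = U * Aᴴ * Uᴴ := fun A => by
        simp only [conjTranspose_mul, conjTranspose_conjTranspose, mul_assoc]
      rw [hY, ketBra_eq, hp]
      have hsingle : p t ⊙ single i j 1 = p t i j • single i j 1 := by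
        ext a b
        by_cases hab : i = a ∧ j = b
        · simp [hab]
        · simp [hab]
      simp only [← hUdef, hst, hmul, schurMap_conj hU, hsingle, conjTranspose_smul,
        conjTranspose_single, star_one]
      constructor
      · congr 2
        ext a b
        by_cases ha : a = j
        · subst ha
          have h1 : p t a b = p t a i * p t i b := by
            rw [← hherm t b a, hk b, star_mul', hherm, hherm, mul_comm]
          simp [h1, ← hherm t a i]
          ring
        · simp [ha]
      · congr 2
        ext a b
        by_cases hb : b = i
        · subst hb
          have h1 : p t a b = p t a j * star (p t b j) := by
            have h2 : p t b j * star (p t b j) = 1 := by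
              rw [hherm, mul_comm, ← hk j, (hmult t).diag_eq_one]
            rw [hk a, mul_assoc, h2, mul_one]
          simp [h1]
          ring
        · simp [hb]
    rw [hN, mem_diagonalAlgebra_iff] at hmem
    obtain ⟨x, hx⟩ := hmem
    have h1 := congrArg (fun Z => (Uᴴ * Z * U) i j) hx
    rw [conj_conj_cancel hU, ketBra_eq, conj_conj_cancel hU, diagonal_apply_ne _ hij] at h1
    simp at h1
  · rw [hpγ, hp]

end diagonal

end QMS

/-! ### The objects attached to the semigroup, in the basis -/

/-- The semigroup `P` acts by Schur multipliers `exp (t γ_ij)` in the basis of the columns of the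
unitary `U`, and its decoherence-free algebra is that of the operators diagonal in this basis. -/
structure IsSchurSemigroup (P : QMS d) (U γ : Mat d) : Prop where
  star_mul_self : Uᴴ * U = 1
  mul_star_self : U * Uᴴ = 1
  generator : IsSchurGenerator γ
  re_neg : ∀ i j, i ≠ j → (γ i j).re < 0
  map_eq : ∀ t : ℝ≥0, P.map t = schurMap U (expMultiplier γ t)
  mem_dfAlgebra_iff : ∀ X, X ∈ P.dfAlgebra ↔ ∃ x : Fin d → ℂ, X = U * diagonal x * Uᴴ

theorem trace_schurMap_mul (U g X Y : Mat d) :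
    (schurMap U g X * Y).trace = ((g ⊙ (Uᴴ * X * U)) * (Uᴴ * Y * U)).trace := by
  rw [schurMap_apply, mul_assoc, trace_mul_comm, ← mul_assoc, trace_mul_comm]

theorem trace_mul_schurMap (U g X Y : Mat d) :
    (X * schurMap U g Y).trace = ((Uᴴ * X * U) * (g ⊙ (Uᴴ * Y * U))).trace := by
  rw [trace_mul_comm, trace_schurMap_mul, trace_mul_comm]

theorem predual_schurMap (U g : Mat d) : predual (schurMap U g) = schurMap U gᵀ := by
  ext1 Y
  refine ext_iff_trace_mul_left.2 fun X => ?_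
  rw [← trace_predual, trace_schurMap_mul, trace_mul_schurMap, trace_mul_hadamard_transpose,
    transpose_transpose]

theorem QMS.IsGenerator.unique {P : QMS d} {L L' : Mat d →ₗ[ℂ] Mat d} (h : P.IsGenerator L)
    (h' : P.IsGenerator L') : L = L' :=
  LinearMap.ext fun X => tendsto_nhds_unique (h X) (h' X)

theorem QMS.IsDFExpectation.unique {P : QMS d} {E E' : Mat d →ₗ[ℂ] Mat d}
    (h : P.IsDFExpectation E) (h' : P.IsDFExpectation E') : E = E' := by
  ext1 X
  have h1 : E (X - E X) = 0 := by rw [map_sub, h.idempotent, sub_self]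
  have h2 : E' (X - E X) = 0 := (h'.ker_iff _).2 ((h.ker_iff _).1 h1)
  have h3 : E X ∈ Set.range E' := by
    rw [h'.range_eq, ← h.range_eq]
    exact ⟨X, rfl⟩
  obtain ⟨Z, hZ⟩ := h3
  rw [map_sub, sub_eq_zero, ← hZ, h'.idempotent] at h2
  rw [← hZ, h2]

theorem QMS.generator_eq {P : QMS d} {L : Mat d →ₗ[ℂ] Mat d} (h : P.IsGenerator L) :
    P.generator = L := by
  have hex : ∃ L, P.IsGenerator L := ⟨L, h⟩
  rw [QMS.generator, dif_pos hex]
  exact hex.choose_spec.unique h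

theorem QMS.dfExpectation_eq {P : QMS d} {E : Mat d →ₗ[ℂ] Mat d} (h : P.IsDFExpectation E) :
    P.dfExpectation = E := by
  have hex : ∃ E, P.IsDFExpectation E := ⟨E, h⟩
  rw [QMS.dfExpectation, dif_pos hex]
  exact hex.choose_spec.unique h

theorem tendsto_schurMap {α : Type*} {l : Filter α} {U X : Mat d} {g : α → Mat d} {g₀ : Mat d}
    (h : ∀ i j, Tendsto (fun t => g t i j) l (𝓝 (g₀ i j))) :
    Tendsto (fun t => schurMap U (g t) X) l (𝓝 (schurMap U g₀ X)) := by
  have h1 : Tendsto (fun t => g t ⊙ (Uᴴ * X * U)) l (𝓝 (g₀ ⊙ (Uᴴ * X * U))) :=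
    tendsto_pi_nhds.2 fun i => tendsto_pi_nhds.2 fun j => (h i j).mul_const _
  have h2 : Continuous fun M : Mat d => U * M * Uᴴ :=
    (continuous_const.matrix_mul continuous_id).matrix_mul continuous_const
  exact (h2.tendsto _).comp h1

theorem tendsto_ampliation {α : Type*} {l : Filter α} {Φ : α → Mat d →ₗ[ℂ] Mat d}
    {Φ₀ : Mat d →ₗ[ℂ] Mat d} (h : ∀ X, Tendsto (fun t => Φ t X) l (𝓝 (Φ₀ X))) (k : ℕ)
    (M : Matrix (Fin k × Fin d) (Fin k × Fin d) ℂ) :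
    Tendsto (fun t => ampliation k (Φ t) M) l (𝓝 (ampliation k Φ₀ M)) :=
  tendsto_pi_nhds.2 fun p => tendsto_pi_nhds.2 fun q =>
    (tendsto_pi_nhds.1 (tendsto_pi_nhds.1 (h _) p.2) q.2)

theorem posSemidef_of_tendsto {n α : Type*} [Fintype n] {l : Filter α} [l.NeBot]
    {M : α → Matrix n n ℂ} {M₀ : Matrix n n ℂ} (h : Tendsto M l (𝓝 M₀))
    (hM : ∀ t, (M t).PosSemidef) : M₀.PosSemidef := by
  refine PosSemidef.of_dotProduct_mulVec_nonneg ?_ fun x => ?_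
  · have h1 : Tendsto (fun t => (M t)ᴴ) l (𝓝 M₀ᴴ) :=
      (continuous_id.matrix_conjTranspose.tendsto _).comp h
    simp only [(hM _).isHermitian.eq] at h1
    exact tendsto_nhds_unique h1 h
  · have h1 : Continuous fun N : Matrix n n ℂ => star x ⬝ᵥ (N *ᵥ x) :=
      continuous_const.dotProduct (continuous_id.matrix_mulVec continuous_const)
    exact ge_of_tendsto' ((h1.tendsto _).comp h) fun t => (hM t).dotProduct_mulVec_nonneg x

namespace IsSchurSemigroup

variable {P : QMS d} {U γ : Mat d}

theorem isGenerator (h : IsSchurSemigroup P U γ) : P.IsGenerator (schurMap U γ) := by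
  intro X
  have h1 : ∀ t : ℝ≥0, ((t : ℝ)⁻¹) • (P.map t X - X) =
      schurMap U (Matrix.of fun i j => ((t : ℝ)⁻¹) • (Complex.exp ((t : ℝ) * γ i j) - 1)) X := by
    intro t
    have hX : X = U * (Uᴴ * X * U) * Uᴴ := (conj_conj_cancel' h.mul_star_self X).symm
    conv_lhs => rw [h.map_eq, schurMap_apply]; arg 2; arg 2; rw [hX]
    rw [← sub_mul, ← mul_sub, schurMap_apply, ← smul_mul_assoc, ← mul_smul_comm]
    congr 2
    ext i j
    simp [expMultiplier]
    ring
  simp only [h1]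
  refine tendsto_schurMap fun i j => ?_
  have h2 : HasDerivAt (fun t : ℝ => Complex.exp ((t : ℂ) * γ i j)) (γ i j) 0 := by
    have h3 : HasDerivAt (fun t : ℝ => (t : ℂ) * γ i j) (1 * γ i j) 0 :=
      (Complex.ofRealCLM.hasDerivAt (x := (0 : ℝ))).mul_const _
    simpa using h3.cexp
  have h4 := hasDerivAt_iff_tendsto_slope_zero.1 h2
  simp only [zero_add, Complex.ofReal_zero, zero_mul, Complex.exp_zero] at h4
  have h5 : Tendsto (fun t : ℝ≥0 => (t : ℝ)) (𝓝[≠] 0) (𝓝[≠] 0) := by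
    refine tendsto_nhdsWithin_iff.2 ⟨?_, ?_⟩
    · exact (NNReal.continuous_coe.tendsto' 0 0 rfl).mono_left nhdsWithin_le_nhds
    · filter_upwards [self_mem_nhdsWithin] with t ht
      simpa using ht
  exact h4.comp h5

theorem tendsto_map_atTop (h : IsSchurSemigroup P U γ) (X : Mat d) :
    Tendsto (fun t => P.map t X) atTop (𝓝 (schurMap U 1 X)) := by
  simp only [h.map_eq]
  refine tendsto_schurMap fun i j => ?_
  simp only [expMultiplier, of_apply]
  by_cases hij : i = j
  · subst hij
    simp [h.generator.diag_eq_zero]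
  · rw [one_apply_ne hij, tendsto_zero_iff_norm_tendsto_zero]
    simp only [Complex.norm_exp, Complex.re_ofReal_mul]
    have h1 : Tendsto (fun t : ℝ≥0 => (t : ℝ) * (γ i j).re) atTop atBot :=
      (NNReal.tendsto_coe_atTop.2 tendsto_id).atTop_mul_const_of_neg (h.re_neg i j hij)
    exact Real.tendsto_exp_atBot.comp h1

/-- The pinching is the long-time limit of the semigroup, from which it inherits its properties. -/
theorem isDFExpectation (h : IsSchurSemigroup P U γ) : P.IsDFExpectation (schurMap U 1) where
  completelyPositive k M hM :=
    posSemidef_of_tendsto (tendsto_ampliation h.tendsto_map_atTop k M)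
      fun t => P.completelyPositive t k M hM
  idempotent X := by
    conv_lhs => rw [schurMap_apply U 1 X, schurMap_conj h.star_mul_self]
    rw [schurMap_apply, ← hadamard_assoc, one_hadamard]
    simp
  range_eq := by
    ext X
    rw [h.mem_dfAlgebra_iff]
    constructor
    · rintro ⟨Y, rfl⟩
      exact ⟨_, by rw [schurMap_apply, one_hadamard]⟩
    · rintro ⟨x, rfl⟩
      refine ⟨U * diagonal x * Uᴴ, ?_⟩
      rw [schurMap_conj h.star_mul_self, one_hadamard]
      simp
  compatible σ hσ X := by
    have h1 : Continuous fun M : Mat d => (σ * M).trace :=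
      (continuous_const.matrix_mul continuous_id).matrix_trace
    have h2 := (h1.tendsto _).comp (h.tendsto_map_atTop X)
    refine tendsto_nhds_unique h2 ?_
    simp only [Function.comp_def, hσ.2.2 _ X]
    exact tendsto_const_nhds
  ker_iff X := by
    constructor
    · intro hX
      exact hX ▸ h.tendsto_map_atTop X
    · intro hX
      exact tendsto_nhds_unique (h.tendsto_map_atTop X) hX

theorem generator_eq (h : IsSchurSemigroup P U γ) : P.generator = schurMap U γ :=
  QMS.generator_eq h.isGenerator

theorem dfExpectation_eq (h : IsSchurSemigroup P U γ) : P.dfExpectation = schurMap U 1 :=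
  QMS.dfExpectation_eq h.isDFExpectation

theorem dfState_eq (h : IsSchurSemigroup P U γ) (ρ : Mat d) : P.dfState ρ = schurMap U 1 ρ := by
  rw [QMS.dfState, h.dfExpectation_eq, predual_schurMap, transpose_one]

theorem refState_eq (h : IsSchurSemigroup P U γ) :
    P.refState = spectralMat 1 (fun _ => (d : ℝ)⁻¹) := by
  rw [QMS.refState, h.dfState_eq, spectralMat_const (by simp), map_smul, schurMap_apply, mul_one,
    h.star_mul_self, one_hadamard]
  simp [h.mul_star_self]

theorem weightedInner_refState (h : IsSchurSemigroup P U γ) (X Y : Mat d) :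
    weightedInner P.refState X Y = (d : ℂ)⁻¹ * (Xᴴ * Y).trace := by
  have hsq : ((√(d : ℝ)⁻¹ : ℝ) : ℂ) * ((√(d : ℝ)⁻¹ : ℝ) : ℂ) = (d : ℂ)⁻¹ := by
    rw [← Complex.ofReal_mul, Real.mul_self_sqrt (by positivity)]
    simp
  rw [weightedInner, h.refState_eq, cfc_spectralMat (by simp) (by simp),
    spectralMat_const (by simp)]
  simp only [smul_mul_assoc, mul_smul_comm, one_mul, mul_one, smul_smul, trace_smul, hsq,
    smul_eq_mul]

end IsSchurSemigroup

namespace IsSchurSemigroup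

variable {P : QMS d} {U γ : Mat d}

/-! ### The Poincaré constant -/

theorem dirichlet_eq (h : IsSchurSemigroup P U γ) {X : Mat d} (hX : X.IsHermitian) :
    P.dirichlet X = (d : ℝ)⁻¹ * ∑ i, ∑ j, -(γ j i).re * ‖(Uᴴ * X * U) i j‖ ^ 2 := by
  have hX' : (Uᴴ * X * U).IsHermitian := isHermitian_conjTranspose_mul_mul U hX
  rw [QMS.dirichlet, h.weightedInner_refState, h.generator_eq, hX.eq, trace_mul_schurMap,
    ← Complex.ofReal_natCast, ← Complex.ofReal_inv, Complex.re_ofReal_mul,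
    re_trace_mul_hadamard_self hX', ← mul_neg, ← Finset.sum_neg_distrib]
  simp only [← Finset.sum_neg_distrib, neg_mul]

theorem dfVariance_eq (h : IsSchurSemigroup P U γ) {X : Mat d} (hX : X.IsHermitian) :
    P.dfVariance X =
      (d : ℝ)⁻¹ * ∑ i, ∑ j, if i = j then 0 else ‖(Uᴴ * X * U) i j‖ ^ 2 := by
  have hX' : (Uᴴ * X * U).IsHermitian := isHermitian_conjTranspose_mul_mul U hX
  set Y := Uᴴ * X * U with hY
  have h1 : X - P.dfExpectation X = U * (Y - 1 ⊙ Y) * Uᴴ := by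
    rw [h.dfExpectation_eq, schurMap_apply, mul_sub, sub_mul, ← hY, hY,
      conj_conj_cancel' h.mul_star_self]
  have h2 : (Y - 1 ⊙ Y).IsHermitian := by
    refine hX'.sub ?_
    rw [IsHermitian, conjTranspose_hadamard, hX'.eq, conjTranspose_one, hadamard_comm]
  have h3 : (U * (Y - 1 ⊙ Y) * Uᴴ)ᴴ * (U * (Y - 1 ⊙ Y) * Uᴴ) =
      U * ((Y - 1 ⊙ Y) * (Y - 1 ⊙ Y)) * Uᴴ := by
    have : (U * (Y - 1 ⊙ Y) * Uᴴ)ᴴ * (U * (Y - 1 ⊙ Y) * Uᴴ) =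
        U * ((Y - 1 ⊙ Y)ᴴ * (Uᴴ * U) * (Y - 1 ⊙ Y)) * Uᴴ := by
      simp only [conjTranspose_mul, conjTranspose_conjTranspose, mul_assoc]
    rw [this, h2.eq, h.star_mul_self, mul_one]
  have h4 := re_trace_mul_hadamard_self h2 (Matrix.of 1)
  rw [of_one_hadamard] at h4
  rw [QMS.dfVariance, h.weightedInner_refState, h1, h3, mul_assoc U, trace_mul_comm, mul_assoc,
    h.star_mul_self, mul_one, ← Complex.ofReal_natCast, ← Complex.ofReal_inv,
    Complex.re_ofReal_mul, h4]
  congr 1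
  refine Finset.sum_congr rfl fun i _ => Finset.sum_congr rfl fun j _ => ?_
  by_cases hij : i = j
  · subst hij
    simp
  · simp [hij]

/-- In the basis, both sides are sums of the `|X_ij|²` over `i ≠ j`. -/
theorem poincareIneq_iff (h : IsSchurSemigroup P U γ) (c : ℝ) :
    P.PoincareIneq c ↔ ∀ i j, i ≠ j → c ≤ -(γ i j).re := by
  constructor
  · intro hc i j hij
    have hd : (0 : ℝ) < d := by
      have : 0 < d := Fin.pos i
      exact_mod_cast this
    -- tested on `|e_i⟩⟨e_j| + |e_j⟩⟨e_i|`
    set K : Mat d := single i j 1 + single j i 1 with hK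
    have hKh : K.IsHermitian := by
      simp [IsHermitian, hK, add_comm]
    have hX : (U * K * Uᴴ).IsHermitian := isHermitian_mul_mul_conjTranspose U hKh
    have h1 := hc _ hX
    rw [h.dirichlet_eq hX, h.dfVariance_eq hX, conj_conj_cancel h.star_mul_self] at h1
    have hsum : ∀ f : Fin d → Fin d → ℝ, ∑ a, ∑ b, f a b * ‖K a b‖ ^ 2 = f i j + f j i := by
      intro f
      have h2 : ∀ a b, f a b * ‖K a b‖ ^ 2 =
          (if a = i then if b = j then f i j else 0 else 0) +
            (if a = j then if b = i then f j i else 0 else 0) := by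
        intro a b
        by_cases ha : a = i
        · subst ha
          by_cases hb : b = j
          · subst hb
            simp [hK, hij, Ne.symm hij]
          · simp [hK, hij, hb, Ne.symm hb, Ne.symm hij]
        · by_cases ha' : a = j
          · subst ha'
            by_cases hb : b = i
            · subst hb
              simp [hK, hij, Ne.symm hij]
            · simp [hK, hij, hb, Ne.symm hb, Ne.symm hij]
          · simp [hK, ha, ha', Ne.symm ha, Ne.symm ha']
      simp only [h2, Finset.sum_add_distrib, Finset.sum_ite_eq', Finset.mem_univ, if_true,
        Finset.sum_ite_irrel, Finset.sum_const_zero]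
    have h3 : ∀ a b, (if a = b then 0 else ‖K a b‖ ^ 2 : ℝ) =
        (if a = b then 0 else 1) * ‖K a b‖ ^ 2 := fun a b => by split_ifs <;> simp
    simp only [h3, hsum, hij, Ne.symm hij, if_false, h.generator.re_symm i j] at h1
    have h4 : (d : ℝ)⁻¹ * (c * 2) ≤ (d : ℝ)⁻¹ * (-(γ i j).re * 2) := by linarith
    have := le_of_mul_le_mul_left h4 (inv_pos.2 hd)
    linarith
  · intro hc X hX
    rw [h.dirichlet_eq hX, h.dfVariance_eq hX, ← mul_assoc, mul_comm c, mul_assoc, Finset.mul_sum]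
    refine mul_le_mul_of_nonneg_left (Finset.sum_le_sum fun i _ => ?_) (by positivity)
    rw [Finset.mul_sum]
    refine Finset.sum_le_sum fun j _ => ?_
    by_cases hij : i = j
    · subst hij
      simp [h.generator.diag_eq_zero]
    · rw [if_neg hij]
      exact mul_le_mul_of_nonneg_right (hc j i (Ne.symm hij)) (sq_nonneg _)

theorem poincareConst_eq (h : IsSchurSemigroup P U γ) {m : ℝ} (hm : ∀ i j, i ≠ j → m ≤ -(γ i j).re)
    (hm' : ∃ i j, i ≠ j ∧ m = -(γ i j).re) : P.poincareConst = (m : EReal) := by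
  obtain ⟨i, j, hij, rfl⟩ := hm'
  refine le_antisymm (iSup₂_le fun c hc => ?_) ?_
  · exact EReal.coe_le_coe_iff.2 ((h.poincareIneq_iff c).1 hc i j hij)
  · exact le_iSup₂_of_le _ ((h.poincareIneq_iff _).2 hm) le_rfl

/-! ### Entropies in terms of eigenvalues -/

theorem trace_conj_mul_spectralMat_conj (hU : Uᴴ * U = 1) (M W : Mat d) (f : Fin d → ℝ) :
    ((U * M * Uᴴ) * spectralMat (U * W) f).trace = (M * spectralMat W f).trace := by
  have : (U * M * Uᴴ) * (U * spectralMat W f * Uᴴ) =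
      U * (M * (Uᴴ * U) * spectralMat W f) * Uᴴ := by
    simp only [mul_assoc]
  rw [← conj_spectralMat, this, hU, mul_one, mul_assoc U, trace_mul_comm, mul_assoc, hU, mul_one]

variable {W : Mat d} {r : Fin d → ℝ}

theorem unitary_mul {V W : Mat d} (hV : Vᴴ * V = 1) (hW : Wᴴ * W = 1) :
    (V * W)ᴴ * (V * W) = 1 := by
  have : (V * W)ᴴ * (V * W) = Wᴴ * (Vᴴ * V) * W := by
    simp only [conjTranspose_mul, mul_assoc]
  rw [this, hV, mul_one, hW]

theorem dfState_spectralMat (h : IsSchurSemigroup P U γ) (hr : ∀ a, 0 ≤ r a) :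
    P.dfState (spectralMat (U * W) r) = spectralMat U (fun i => (spectralMat W r i i).re) := by
  rw [h.dfState_eq, ← conj_spectralMat, schurMap_conj h.star_mul_self, one_hadamard]
  change _ = U * diagonal (fun i => ((spectralMat W r i i).re : ℂ)) * Uᴴ
  congr 3
  ext i
  refine Complex.ext rfl ?_
  simpa using (Complex.le_def.1 (posSemidef_spectralMat W hr).diag_nonneg).2.symm

theorem dfEntropy_spectralMat (h : IsSchurSemigroup P U γ) (hW : Wᴴ * W = 1)
    (hr : ∀ a, 0 ≤ r a) :
    P.dfEntropy (spectralMat (U * W) r) =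
      ((∑ a, r a * Real.log (r a) -
        ∑ i, (spectralMat W r i i).re * Real.log (spectralMat W r i i).re : ℝ) : EReal) := by
  have hUW := unitary_mul h.star_mul_self hW
  have hρ := posSemidef_spectralMat W hr
  have hker : ∀ v : Fin d → ℂ, P.dfState (spectralMat (U * W) r) *ᵥ v = 0 →
      spectralMat (U * W) r *ᵥ v = 0 := by
    intro v hv
    -- a vanishing diagonal entry of a positive matrix forces its column to vanish
    have hcol : ∀ i, (spectralMat W r i i).re = 0 → ∀ j, spectralMat W r j i = 0 := by
      intro i hi j
      have h1 := (hρ.dotProduct_mulVec_zero_iff (Pi.single i 1)).1 (by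
        rw [← Pi.single_star, star_one, single_dotProduct, mulVec_single_one, one_mul, col_apply]
        refine Complex.ext hi ?_
        simpa using (Complex.le_def.1 hρ.diag_nonneg).2.symm)
      simpa using congrFun h1 j
    set u := Uᴴ *ᵥ v with hu
    have hu0 : ∀ i, ((spectralMat W r i i).re : ℂ) * u i = 0 := by
      intro i
      have h1 := congrArg (fun z => (Uᴴ *ᵥ z) i) hv
      simp only [h.dfState_spectralMat hr, mulVec_zero, Pi.zero_apply] at h1
      rw [spectralMat, mulVec_mulVec, ← mul_assoc, ← mul_assoc, h.star_mul_self, one_mul,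
        ← mulVec_mulVec, mulVec_diagonal] at h1
      exact h1
    have h2 : spectralMat W r *ᵥ u = 0 := by
      ext j
      simp only [mulVec, dotProduct, Pi.zero_apply]
      refine Finset.sum_eq_zero fun i _ => ?_
      rcases mul_eq_zero.1 (hu0 i) with h3 | h3
      · rw [hcol i (by exact_mod_cast h3) j, zero_mul]
      · rw [h3, mul_zero]
    rw [← conj_spectralMat, ← mulVec_mulVec, ← mulVec_mulVec, ← hu, h2, mulVec_zero]
  rw [QMS.dfEntropy, relEntropy, if_pos hker]
  congr 1
  rw [mul_sub, trace_sub, Complex.sub_re, h.dfState_spectralMat hr,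
    cfc_spectralMat hUW (mul_eq_one_comm.1 hUW), cfc_spectralMat h.star_mul_self h.mul_star_self,
    spectralMat_mul hUW, trace_spectralMat hUW, Complex.ofReal_re]
  congr 1
  have h1 := trace_conj_mul_spectralMat_conj h.star_mul_self (spectralMat W r) 1
    (fun i => Real.log (spectralMat W r i i).re)
  rw [mul_one, conj_spectralMat] at h1
  rw [h1, trace, Complex.re_sum]
  refine Finset.sum_congr rfl fun i _ => ?_
  have h2 : ∀ f : Fin d → ℝ, spectralMat 1 f = diagonal fun i => (f i : ℂ) := fun f => by
    rw [spectralMat, one_mul, conjTranspose_one, mul_one]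
  rw [diag_apply, h2, mul_diagonal, mul_comm, Complex.re_ofReal_mul, mul_comm]

/-- The reference state does not contribute: its logarithm is scalar and `L_*(ρ)` has trace zero. -/
theorem entropyProduction_spectralMat (h : IsSchurSemigroup P U γ) (hW : Wᴴ * W = 1)
    (hker : ∀ v : Fin d → ℂ, spectralMat (U * W) r *ᵥ v = 0 →
      star v ⬝ᵥ (predual P.generator (spectralMat (U * W) r) *ᵥ v) = 0) :
    P.entropyProduction (spectralMat (U * W) r) =
      ((-((γᵀ ⊙ spectralMat W r) * spectralMat W fun a => Real.log (r a)).trace.re : ℝ) :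
        EReal) := by
  have hUW := unitary_mul h.star_mul_self hW
  rw [QMS.entropyProduction, if_pos hker]
  congr 2
  rw [h.generator_eq, predual_schurMap, h.refState_eq,
    cfc_spectralMat hUW (mul_eq_one_comm.1 hUW), cfc_spectralMat (by simp) (by simp),
    ← conj_spectralMat U W r, schurMap_conj h.star_mul_self, mul_sub, trace_sub,
    spectralMat_const (by simp), mul_smul_comm, mul_one, trace_smul,
    trace_conj_mul_spectralMat_conj h.star_mul_self,
    mul_assoc U, trace_mul_comm U, mul_assoc, h.star_mul_self, mul_one]
  simp [trace, h.generator.diag_eq_zero]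

theorem predual_generator_spectralMat (h : IsSchurSemigroup P U γ) :
    predual P.generator (spectralMat (U * W) r) = U * (γᵀ ⊙ spectralMat W r) * Uᴴ := by
  rw [h.generator_eq, predual_schurMap, ← conj_spectralMat, schurMap_conj h.star_mul_self]

/-! ### The lower bound of the log-Sobolev constant -/

theorem le_entropyProduction_div (h : IsSchurSemigroup P U γ) {g : ℝ} (hg : 0 < g)
    (hγg : ∀ i j, i ≠ j → g ≤ -(γ i j).re) (hd : 1 ≤ d) {ρ : Mat d} (hρ : IsState ρ)
    (hne : P.dfState ρ ≠ ρ) :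
    ((g / (16 * d ^ 3) : ℝ) : EReal) ≤ P.entropyProduction ρ / (2 * P.dfEntropy ρ) := by
  have hd1 : (1 : ℝ) ≤ d := by exact_mod_cast hd
  obtain ⟨W, r, hW, hW', hρW⟩ : ∃ (W : Mat d) (r : Fin d → ℝ), Wᴴ * W = 1 ∧ W * Wᴴ = 1 ∧
      ρ = spectralMat (U * W) r := by
    obtain ⟨W, r, hW, hW', hρW⟩ :=
      exists_eq_spectralMat (isHermitian_conjTranspose_mul_mul U hρ.1.isHermitian)
    exact ⟨W, r, hW, hW', by rw [← conj_spectralMat, ← hρW, conj_conj_cancel' h.mul_star_self]⟩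
  have hUW := unitary_mul h.star_mul_self hW
  have hr : ∀ a, 0 ≤ r a := nonneg_of_posSemidef_spectralMat hUW (hρW ▸ hρ.1)
  have hpos : 0 < ∑ a, r a * Real.log (r a) -
      ∑ i, (spectralMat W r i i).re * Real.log (spectralMat W r i i).re := by
    refine sub_pos.2 (entropy_diag_lt hW hW' hr fun heq => hne ?_)
    rw [hρW, h.dfState_eq, ← conj_spectralMat, schurMap_conj h.star_mul_self, heq]
  rw [hρW, h.dfEntropy_spectralMat hW hr]
  set D := ∑ a, r a * Real.log (r a) -
      ∑ i, (spectralMat W r i i).re * Real.log (spectralMat W r i i).re with hD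
  have h2 : (2 : EReal) * (D : EReal) = ((2 * D : ℝ) : EReal) := by
    rw [EReal.coe_mul]
    rfl
  rw [h2]
  by_cases hker : ∀ v : Fin d → ℂ, spectralMat (U * W) r *ᵥ v = 0 →
      star v ⬝ᵥ (predual P.generator (spectralMat (U * W) r) *ᵥ v) = 0
  · rw [h.entropyProduction_spectralMat hW hker, ← EReal.coe_div, EReal.coe_le_coe_iff]
    have hmain := h.generator.mul_entropy_le hg.le hγg hd hW hW' hr (fun a ha => by
      have h3 := spectralMat_mulVec hUW r a
      rw [ha, Complex.ofReal_zero, zero_smul] at h3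
      have h4 := hker _ h3
      have h5 : (U * W).col a = U *ᵥ W.col a := by
        ext i
        simp [mul_apply, mulVec, dotProduct]
      rw [h.predual_generator_spectralMat, h5, mulVec_mulVec, mul_assoc, h.star_mul_self, mul_one,
        ← mulVec_mulVec, star_mulVec, ← dotProduct_mulVec, mulVec_mulVec, h.star_mul_self,
        one_mulVec] at h4
      exact h4)
    rw [← hD] at hmain
    rw [div_le_div_iff₀ (by positivity) (by positivity)]
    linarith
  -- infinite entropy production
  · rw [QMS.entropyProduction, if_neg hker, EReal.top_div_of_pos_ne_top
      (by exact_mod_cast (by positivity : 0 < 2 * D)) (EReal.coe_ne_top _)]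
    exact le_top

theorem logSobolevConst_pos (h : IsSchurSemigroup P U γ) {g : ℝ} (hg : 0 < g)
    (hγg : ∀ i j, i ≠ j → g ≤ -(γ i j).re) (hd : 1 ≤ d) : 0 < P.logSobolevConst := by
  have hd1 : (0 : ℝ) < d := by exact_mod_cast hd
  have h1 : (0 : EReal) < ((g / (16 * d ^ 3) : ℝ) : EReal) := by
    exact_mod_cast (by positivity : 0 < g / (16 * (d : ℝ) ^ 3))
  exact h1.trans_le (le_iInf₂ fun ρ hρ => le_iInf fun hne =>
    h.le_entropyProduction_div hg hγg hd hρ hne)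

end IsSchurSemigroup

/-! ### The log-Sobolev constant is at most the Poincaré constant -/

/-- The quotient of entropy production and relative entropy at a perturbation of size `ε` of the
maximally mixed state, relative to its limit for `ε → 0`. -/
theorem log_quotient_le {ε : ℝ} (h0 : 0 < ε) (h1 : ε < 1 / 2) :
    ε * (Real.log (1 + ε) - Real.log (1 - ε)) /
        (2 * ((1 + ε) * Real.log (1 + ε) + (1 - ε) * Real.log (1 - ε))) ≤
      (1 + ε) / (1 - 2 * ε ^ 2) := by
  have hp : 0 < 1 + ε := by linarith
  have hm : 0 < 1 - ε := by linarith
  have hq : 0 < 1 - 2 * ε ^ 2 := by nlinarith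
  have hpm : 0 < 1 - ε ^ 2 := by nlinarith
  set x := Real.log (1 + ε)
  set y := Real.log (1 - ε)
  have hdiff : x - y = Real.log ((1 + ε) / (1 - ε)) := (Real.log_div hp.ne' hm.ne').symm
  have hup : x - y ≤ 2 * ε / (1 - ε) := by
    rw [hdiff]
    refine (Real.log_le_sub_one_of_pos (by positivity)).trans (le_of_eq ?_)
    field_simp
    ring
  have hlow : 2 * ε ≤ x - y := by
    have h2 := Real.le_log_one_add_of_nonneg (x := 2 * ε / (1 - ε)) (by positivity)
    have h3 : 1 + 2 * ε / (1 - ε) = (1 + ε) / (1 - ε) := by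
      field_simp
      ring
    have h4 : 2 * (2 * ε / (1 - ε)) / (2 * ε / (1 - ε) + 2) = 2 * ε := by
      have h5 : 2 * ε / (1 - ε) + 2 = 2 / (1 - ε) := by
        field_simp
        ring
      rw [h5]
      field_simp
    rw [h3, h4, ← hdiff] at h2
    exact h2
  have hsum : -(ε ^ 2 / (1 - ε ^ 2)) ≤ x + y := by
    have h2 : x + y = Real.log (1 - ε ^ 2) := by
      rw [← Real.log_mul hp.ne' hm.ne']
      congr 1
      ring
    rw [h2]
    refine le_trans (le_of_eq ?_) (Real.one_sub_inv_le_log_of_pos hpm)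
    field_simp
    ring
  have hden : ε ^ 2 * (1 - 2 * ε ^ 2) / (1 - ε ^ 2) ≤ (1 + ε) * x + (1 - ε) * y := by
    have h2 : ε ^ 2 * (1 - 2 * ε ^ 2) / (1 - ε ^ 2) = -(ε ^ 2 / (1 - ε ^ 2)) + ε * (2 * ε) := by
      field_simp
      ring
    rw [h2]
    have := mul_le_mul_of_nonneg_left hlow h0.le
    linarith
  have hpos : 0 < ε ^ 2 * (1 - 2 * ε ^ 2) / (1 - ε ^ 2) := by positivity
  have h2 : ε * (x - y) ≤ ε * (2 * ε / (1 - ε)) := mul_le_mul_of_nonneg_left hup h0.le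
  calc _ ≤ ε * (2 * ε / (1 - ε)) / (2 * (ε ^ 2 * (1 - 2 * ε ^ 2) / (1 - ε ^ 2))) :=
        div_le_div₀ (by positivity) h2 (by positivity) (by linarith)
    _ = _ := by
        have h3 : 1 - ε ^ 2 = (1 - ε) * (1 + ε) := by ring
        rw [h3]
        field_simp

theorem spectralMat_injective {V : Mat d} (hV : Vᴴ * V = 1) {r s : Fin d → ℝ}
    (h : spectralMat V r = spectralMat V s) : r = s := by
  have h1 := congrArg (fun Z => Vᴴ * Z * V) h
  simp only [spectralMat, conj_conj_cancel hV] at h1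
  funext i
  simpa using congrFun (congrFun h1 i) i

theorem spectralMat_const_mul {V : Mat d} (hV : Vᴴ * V = 1) (hV' : V * Vᴴ = 1) (c : ℝ)
    (r : Fin d → ℝ) : spectralMat V (fun a => c * r a) = (c : ℂ) • spectralMat V r := by
  rw [← spectralMat_mul hV, spectralMat_const hV', smul_mul_assoc, one_mul]

namespace IsSchurSemigroup

variable {P : QMS d} {U γ : Mat d}

/-- The test state is `d⁻¹ (1 + ε K)` with `K = |e_i⟩⟨e_j| + |e_j⟩⟨e_i|`. As `K³ = K`, functions of
`K` are quadratic polynomials in `K`. -/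
theorem logSobolevConst_le (h : IsSchurSemigroup P U γ) {i j : Fin d} (hij : i ≠ j) {ε : ℝ}
    (h0 : 0 < ε) (h1 : ε < 1 / 2) :
    P.logSobolevConst ≤ ((-(γ i j).re * ((1 + ε) / (1 - 2 * ε ^ 2)) : ℝ) : EReal) := by
  have hd : (0 : ℝ) < d := by
    have : 0 < d := Fin.pos i
    exact_mod_cast this
  have hquot := log_quotient_le h0 h1
  set x := Real.log (1 + ε) with hx
  set y := Real.log (1 - ε) with hy
  set K : Mat d := single i j 1 + single j i 1 with hK
  have hKh : K.IsHermitian := by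
    simp [IsHermitian, hK, add_comm]
  have hKK : K * K = single i i 1 + single j j 1 := by
    simp [hK, mul_add, add_mul, single_mul_single_same, hij, Ne.symm hij, add_comm]
  have hKKK : K * K * K = K := by
    rw [hKK]
    simp [hK, mul_add, add_mul, single_mul_single_same, hij, Ne.symm hij]
  obtain ⟨V, κ, hV, hV', hKV⟩ := exists_eq_spectralMat hKh
  have hκ3 : ∀ a, κ a * κ a * κ a = κ a := by
    rw [hKV, spectralMat_mul hV, spectralMat_mul hV] at hKKK
    exact congrFun (spectralMat_injective hV hKKK)
  have hκ : ∀ a, κ a = 0 ∨ κ a = 1 ∨ κ a = -1 := fun a => by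
    have h2 : κ a * ((κ a - 1) * (κ a + 1)) = 0 := by linear_combination hκ3 a
    rcases mul_eq_zero.1 h2 with h3 | h3
    · exact Or.inl h3
    · rcases mul_eq_zero.1 h3 with h4 | h4
      · exact Or.inr (Or.inl (by linarith))
      · exact Or.inr (Or.inr (by linarith))
  have hκ1 : ∑ a, κ a = 0 := by
    have h2 := trace_spectralMat hV κ
    rw [← hKV, hK, trace_add, trace_single_eq_of_ne _ _ _ hij,
      trace_single_eq_of_ne _ _ _ hij.symm, add_zero] at h2
    exact_mod_cast h2.symm
  have hκ2 : ∑ a, κ a * κ a = 2 := by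
    have h2 := trace_spectralMat hV fun a => κ a * κ a
    rw [← spectralMat_mul hV, ← hKV, hKK, trace_add, trace_single_eq_same,
      trace_single_eq_same] at h2
    have h3 : ((∑ a, κ a * κ a : ℝ) : ℂ) = ((2 : ℝ) : ℂ) := by
      rw [← h2]
      norm_num
    exact_mod_cast h3
  set r : Fin d → ℝ := fun a => (d : ℝ)⁻¹ + (d : ℝ)⁻¹ * ε * κ a with hr
  have hr' : ∀ a, r a = (d : ℝ)⁻¹ * (1 + ε * κ a) := fun a => by
    simp only [hr]
    ring
  have hrpos : ∀ a, 0 < r a := fun a => by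
    rw [hr']
    refine mul_pos (inv_pos.2 hd) ?_
    rcases hκ a with h2 | h2 | h2 <;> rw [h2] <;> linarith
  set c := Real.log (d : ℝ)⁻¹ with hc
  -- interpolation of the logarithm at the eigenvalues `0`, `1`, `-1` of `K`
  have hlog : ∀ a, Real.log (r a) = c + ((x - y) / 2 * κ a + (x + y) / 2 * (κ a * κ a)) := by
    intro a
    have h2 : 1 + ε * κ a ≠ 0 := by
      have h3 := hrpos a
      rw [hr'] at h3
      exact (pos_of_mul_pos_right h3 (inv_pos.2 hd).le).ne'
    rw [hr', Real.log_mul (inv_pos.2 hd).ne' h2, ← hc]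
    congr 1
    rcases hκ a with h3 | h3 | h3 <;> rw [h3]
    · simp
    · rw [mul_one, ← hx]
      ring
    · rw [mul_neg, mul_one, ← sub_eq_add_neg, ← hy]
      ring
  have hρK : spectralMat V r = (((d : ℝ)⁻¹ : ℝ) : ℂ) • (1 : Mat d) +
      (((d : ℝ)⁻¹ * ε : ℝ) : ℂ) • K := by
    rw [hr, ← spectralMat_add, spectralMat_const hV', spectralMat_const_mul hV hV', ← hKV]
  have hlogK : spectralMat V (fun a => Real.log (r a)) = (c : ℂ) • (1 : Mat d) +
      ((((x - y) / 2 : ℝ) : ℂ) • K + (((x + y) / 2 : ℝ) : ℂ) • (single i i 1 + single j j 1)) := by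
    simp only [hlog]
    rw [← spectralMat_add, ← spectralMat_add, spectralMat_const hV', spectralMat_const_mul hV hV',
      spectralMat_const_mul hV hV', ← spectralMat_mul hV, ← hKV, hKK]
  have hKdiag : ∀ a, K a a = 0 := fun a => by
    have h2 : ¬(i = a ∧ j = a) := fun h => hij (h.1.trans h.2.symm)
    have h3 : ¬(j = a ∧ i = a) := fun h => hij (h.2.trans h.1.symm)
    simp [hK, h2, h3]
  have hKij : K i j = 1 := by simp [hK, hij, Ne.symm hij]
  have hKji : K j i = 1 := by simp [hK, hij, Ne.symm hij]
  have hUV := unitary_mul h.star_mul_self hV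
  set ρ := spectralMat (U * V) r with hρ
  have hsum : ∑ a, r a = 1 := by
    simp only [hr, Finset.sum_add_distrib, ← Finset.mul_sum, hκ1]
    simp [hd.ne']
  have hstate : IsState ρ :=
    ⟨posSemidef_spectralMat _ fun a => (hrpos a).le, by rw [hρ, trace_spectralMat hUV, hsum]; simp⟩
  have hne : P.dfState ρ ≠ ρ := by
    intro heq
    have h2 := congrArg (fun Z => (Uᴴ * Z * U) i j) heq
    rw [h.dfState_eq, hρ, ← conj_spectralMat, schurMap_conj h.star_mul_self,
      conj_conj_cancel h.star_mul_self, conj_conj_cancel h.star_mul_self, hadamard_apply,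
      one_apply_ne hij, hρK, zero_mul] at h2
    simp only [hKij, Matrix.add_apply, Matrix.smul_apply, one_apply_ne hij, smul_eq_mul, mul_zero,
      mul_one, zero_add] at h2
    have h3 : (d : ℝ)⁻¹ * ε = 0 := by exact_mod_cast h2.symm
    exact (mul_pos (inv_pos.2 hd) h0).ne' h3
  have hent : P.dfEntropy ρ = (((d : ℝ)⁻¹ * ((1 + ε) * x + (1 - ε) * y) : ℝ) : EReal) := by
    rw [hρ, h.dfEntropy_spectralMat hV fun a => (hrpos a).le]
    congr 1
    have h2 : ∀ k, (spectralMat V r k k).re = (d : ℝ)⁻¹ := fun k => by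
      rw [hρK]
      simp [hKdiag]
    have h3 : ∀ a, r a * Real.log (r a) = (d : ℝ)⁻¹ * (c + ((x - y) / 2 + ε * c +
        ε * ((x + y) / 2)) * κ a + ((x + y) / 2 + ε * ((x - y) / 2)) * (κ a * κ a)) := fun a => by
      rw [hlog, hr']
      linear_combination ((d : ℝ)⁻¹ * ε * ((x + y) / 2)) * hκ3 a
    simp only [h2, h3, ← Finset.mul_sum, Finset.sum_add_distrib, hκ1, hκ2, ← hc]
    simp only [Finset.sum_const, Finset.card_univ, Fintype.card_fin, nsmul_eq_mul]
    field_simp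
    ring
  have hEP : P.entropyProduction ρ =
      (((d : ℝ)⁻¹ * (ε * (x - y) * -(γ i j).re) : ℝ) : EReal) := by
    rw [hρ, h.entropyProduction_spectralMat hV]
    · congr 1
      set M := γᵀ ⊙ spectralMat V r with hM
      have hMdiag : ∀ k, M k k = 0 := fun k => by simp [hM, h.generator.diag_eq_zero]
      have hMij : M i j = γ j i * (((d : ℝ)⁻¹ * ε : ℝ) : ℂ) := by
        rw [hM, hρK]
        simp [hij, hKij]
      have hMji : M j i = γ i j * (((d : ℝ)⁻¹ * ε : ℝ) : ℂ) := by
        rw [hM, hρK]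
        simp [Ne.symm hij, hKji]
      have htr : (M * spectralMat V (fun a => Real.log (r a))).trace =
          (((x - y) / 2 * ((d : ℝ)⁻¹ * ε) : ℝ) : ℂ) * (γ i j + γ j i) := by
        rw [hlogK, mul_add, mul_add, mul_smul_comm, mul_smul_comm, mul_smul_comm, mul_add,
          mul_one, mul_add]
        simp only [trace_add, trace_smul, trace_mul_single, hMdiag, hMij, hMji]
        rw [show M.trace = 0 by simp [trace, hMdiag]]
        simp
        ring
      rw [htr, Complex.re_ofReal_mul, Complex.add_re, h.generator.re_symm i j]
      ring
    · intro v hv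
      have h2 : v = 0 := by
        have h3 := congrArg (fun z => spectralMat (U * V) (fun a => (r a)⁻¹) *ᵥ z) hv
        simp only [mulVec_mulVec, mulVec_zero] at h3
        rw [spectralMat_mul hUV] at h3
        simp only [inv_mul_cancel₀ (hrpos _).ne'] at h3
        rw [spectralMat_const (mul_eq_one_comm.1 hUV)] at h3
        simpa using h3
      simp [h2]
  have hle := iInf₂_le_of_le (f := fun (ρ : Mat d) (_ : IsState ρ) =>
    ⨅ _ : P.dfState ρ ≠ ρ, P.entropyProduction ρ / (2 * P.dfEntropy ρ)) ρ hstate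
    (iInf_le_of_le hne le_rfl)
  refine le_trans hle ?_
  have h2 : (2 : EReal) * (((d : ℝ)⁻¹ * ((1 + ε) * x + (1 - ε) * y) : ℝ) : EReal) =
      ((2 * ((d : ℝ)⁻¹ * ((1 + ε) * x + (1 - ε) * y)) : ℝ) : EReal) := by
    rw [EReal.coe_mul 2]
    rfl
  rw [hEP, hent, h2, ← EReal.coe_div, EReal.coe_le_coe_iff]
  have h3 : (d : ℝ)⁻¹ * (ε * (x - y) * -(γ i j).re) /
      (2 * ((d : ℝ)⁻¹ * ((1 + ε) * x + (1 - ε) * y))) =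
      -(γ i j).re * (ε * (x - y) / (2 * ((1 + ε) * x + (1 - ε) * y))) := by
    field_simp
  rw [h3]
  exact mul_le_mul_of_nonneg_left hquot (by linarith [h.re_neg i j hij])

theorem logSobolevConst_le_neg_re (h : IsSchurSemigroup P U γ) {i j : Fin d} (hij : i ≠ j) :
    P.logSobolevConst ≤ ((-(γ i j).re : ℝ) : EReal) := by
  have h1 : ContinuousAt (fun ε : ℝ => -(γ i j).re * ((1 + ε) / (1 - 2 * ε ^ 2))) 0 := by
    refine continuousAt_const.mul (ContinuousAt.div (by fun_prop) (by fun_prop) (by norm_num))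
  have h2 := (continuous_coe_real_ereal.tendsto _).comp
    (h1.tendsto.mono_left (nhdsWithin_le_nhds (s := Set.Ioi 0)))
  have h3 := ge_of_tendsto h2 (by
    filter_upwards [Ioo_mem_nhdsGT (show (0 : ℝ) < 1 / 2 by norm_num)] with ε hε
    exact h.logSobolevConst_le hij hε.1 hε.2)
  simpa using h3

end IsSchurSemigroup

/-! ### The semigroup with diagonal decoherence-free algebra -/

theorem isSchurSemigroup_of_dfAlgebra_eq {P : QMS d}
    {e : OrthonormalBasis (Fin d) ℂ (EuclideanSpace ℂ (Fin d))}
    (hN : P.dfAlgebra = diagonalAlgebra e) :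
    ∃ γ : Mat d, IsSchurSemigroup P (basisMat e) γ := by
  obtain ⟨γ, hγ, hneg, hmap⟩ := QMS.exists_schurGenerator hN
  exact ⟨γ, conjTranspose_mul_basisMat e, basisMat_mul_conjTranspose e, hγ, hneg, hmap,
    fun X => by rw [hN, mem_diagonalAlgebra_iff]⟩

end DFree

end

theorem theorem6p1 (d : ℕ) (hd : 2 ≤ d) (P : DFree.QMS d)
    (hP : ∃ σ : DFree.Mat d, P.IsFaithfulInvariantState σ)
    (e : OrthonormalBasis (Fin d) ℂ (EuclideanSpace ℂ (Fin d)))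
    (hN : P.dfAlgebra = DFree.diagonalAlgebra e) :
    ∃ γ : Fin d → Fin d → ℂ,
      (∀ i j, P.generator (DFree.ketBra e i j) = γ i j • DFree.ketBra e i j) ∧
      0 < P.logSobolevConst ∧
      P.logSobolevConst ≤ P.poincareConst ∧
      IsLeast {r : EReal | ∃ i j : Fin d, i ≠ j ∧ r = ((-(γ i j).re : ℝ) : EReal)}
        P.poincareConst := by
  obtain ⟨γ, h⟩ := DFree.isSchurSemigroup_of_dfAlgebra_eq hN
  obtain ⟨⟨⟨i₀, j₀⟩, hij₀⟩, hmin⟩ : ∃ p : {p : Fin d × Fin d // p.1 ≠ p.2},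
      ∀ q : {p : Fin d × Fin d // p.1 ≠ p.2}, -(γ p.1.1 p.1.2).re ≤ -(γ q.1.1 q.1.2).re := by
    have : Nonempty {p : Fin d × Fin d // p.1 ≠ p.2} :=
      ⟨⟨(⟨0, by omega⟩, ⟨1, by omega⟩), by simp⟩⟩
    exact Finite.exists_min fun p : {p : Fin d × Fin d // p.1 ≠ p.2} => -(γ p.1.1 p.1.2).re
  have hmin' : ∀ i j, i ≠ j → -(γ i₀ j₀).re ≤ -(γ i j).re := fun i j hij => hmin ⟨(i, j), hij⟩
  have hpc := h.poincareConst_eq hmin' ⟨i₀, j₀, hij₀, rfl⟩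
  refine ⟨γ, fun i j => ?_, ?_, ?_, ?_⟩
  · rw [h.generator_eq, DFree.ketBra_eq, DFree.schurMap_conj h.star_mul_self]
    have h1 : γ ⊙ Matrix.single i j 1 = γ i j • Matrix.single i j 1 := by
      ext a b
      by_cases hab : i = a ∧ j = b
      · simp [hab]
      · simp [hab]
    rw [h1, mul_smul_comm, smul_mul_assoc]
  · exact h.logSobolevConst_pos (neg_pos.2 (h.re_neg i₀ j₀ hij₀)) hmin' (by omega)
  · rw [hpc]
    exact h.logSobolevConst_le_neg_re hij₀
  · rw [hpc]
    refine ⟨⟨i₀, j₀, hij₀, rfl⟩, ?_⟩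
    rintro _ ⟨i, j, hij, rfl⟩
    exact EReal.coe_le_coe_iff.2 (hmin' i j hij)
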